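/- Throughout, $A\approx B$ means $cB\le A\le CB$ with positive constants $c,C$ independent of the variable ($t>0$, or the function $f$), and $\|\cdot\|_{q,(a,b)}$ is the $L^q$-quasi-norm on $(a,b)$. A Lebesgue measurable $b:(0,\infty)\to(0,\infty)$ is slowly varying, $b\in SV$, if for every $\varepsilon>0$ the functions $t^{\varepsilon}b(t)$ and $t^{-\varepsilon}b(t)$ are equivalent ($\approx$) on $(0,\infty)$ to a positive non-decreasing and a positive non-increasing function, respectively; $b\in SV_{0,q}$ if moreover $\|u^{-1/q}b(u)\|_{q,(1,\infty)}<\infty$. For two spaces $A_0,A_1$ with semi-quasi-norms inside a common vector space, put $$K(t,f;A_0,A_1)=\inf\{\|f_0\|_{A_0}+t\|f_1\|_{A_1}: f=f_0+f_1,\ f_j\in A_j\},$$ and let $(A_0,A_1)_{\theta,q;b}$ be the space of all $f\in A_0+A_1$ for which $\|f\|_{\theta,q;b}=\|t^{-\theta-1/q}b(t)K(t,f;A_0,A_1)\|_{q,(0,\infty)}$ is finite. Let $E$ be a rearrangement-invariant Banach function space on $\mathbb{R}^n$ (in the sense of Bennett and Sharpley), and let $\omega_E(f,t)=\sup_{|h|\le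 t}\|f(\cdot+h)-f\|_E$ for $f\in E$. For $0<q<\infty$ and a positive weight $b$ on $(0,\infty)$, the homogeneous Besov space $B^{0,b}_{E,q}$ consists of all $f\in E$ for which the semi-quasi-norm $$\|f\|_{B^{0,b}_{E,q}}=\|t^{-1/q}b(t)\,\omega_E(f,t)\|_{q,(0,\infty)}$$ is finite. **Theorem.** Let $0<q_0,q_1,q<\infty$ with $q_0\ne q_1$, let $0<\theta<1$, $b_j\in SV_{0,q_j}$ $(j=0,1)$ and $b\in SV$. Put $$\rho(t)=\frac{\|u^{-1/q_0}b_0(u)\|_{q_0,(t,\infty)}}{\|u^{-1/q_1}b_1(u)\|_{q_1,(t,\infty)}},\qquad \rho_\epsilon(t)=\frac{\|u^{-1/q_0}b_0(u)\|_{q_0,(t,\infty)}^{1+\epsilon}}{\|u^{-1/q_1}b_1(u)\|_{q_1,(t,\infty)}}\qquad(t>0).$$ Assume that for some $\epsilon>0$ the function $\rho_\epsilon$ is equivalent to a non-decreasing function on $(0,\infty)$, and that $\rho$ is non-decreasing on $(0,\infty)$ with $\lim_{t\to0^+}\rho(t)=0$ and $\lim_{t\to\infty}\rho(t)=\infty$.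 Let $$\tilde b(t)=[\rho(t)]^{1-\theta}\,b(\rho(t))\,[b_1(t)]^{q_1/q}\left(\int_t^\infty b_1^{q_1}(u)\frac{du}{u}\right)^{1/q_1-1/q},\qquad t>0.$$ Then $$\left(B^{0,b_0}_{E,q_0},\,B^{0,b_1}_{E,q_1}\right)_{\theta,q;b}=B^{0,\tilde b}_{E,q},$$ that is, both spaces consist of the same functions, and their semi-quasi-norms are equivalent. -/

import Mathlib

open MeasureTheory Set Filter Topology
open scoped ENNReal NNReal Pointwise

noncomputable section

namespace LimitingInterpolation

/-! ### Slowly varying functions -/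

/-- `f ≈ g` on `(0, ∞)`. -/
def EquivPos (f g : ℝ → ℝ) : Prop :=
  ∃ c C : ℝ, 0 < c ∧ 0 < C ∧ ∀ t, 0 < t → c * g t ≤ f t ∧ f t ≤ C * g t

/-- The class `SV` of slowly varying functions `b : (0, ∞) → (0, ∞)`. Such a function is
represented by a function on `ℝ`, whose values on `(-∞, 0]` play no role. Almost everywhere
measurability with respect to Lebesgue measure is Lebesgue measurability. -/
structure SlowlyVarying (b : ℝ → ℝ) : Prop where
  aemeasurable : AEMeasurable b (volume.restrict (Ioi 0))
  pos : ∀ t, 0 < t → 0 < b t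
  equiv_monotone : ∀ ε : ℝ, 0 < ε → ∃ g : ℝ → ℝ, (∀ t, 0 < t → 0 < g t) ∧
    MonotoneOn g (Ioi 0) ∧ EquivPos (fun t => t ^ ε * b t) g
  equiv_antitone : ∀ ε : ℝ, 0 < ε → ∃ g : ℝ → ℝ, (∀ t, 0 < t → 0 < g t) ∧
    AntitoneOn g (Ioi 0) ∧ EquivPos (fun t => t ^ (-ε) * b t) g

/-- The class `SV_{0,q}` (`0 < q < ∞`): slowly varying `b` with
`‖u ^ (-1/q) b(u)‖_{q,(1,∞)} < ∞`. -/
structure SlowlyVaryingZero (q : ℝ) (b : ℝ → ℝ) : Prop extends SlowlyVarying b where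
  tail_lt_top :
    eLpNorm' (fun u : ℝ => u ^ (-(1 / q)) * b u) q (volume.restrict (Ioi 1)) < ∞

/-- The number `‖u ^ (-1/q) b(u)‖_{q,(t,∞)}`, finite for `b ∈ SV_{0,q}` and `t > 0`. -/
def tailNorm (q : ℝ) (b : ℝ → ℝ) (t : ℝ) : ℝ :=
  (eLpNorm' (fun u : ℝ => u ^ (-(1 / q)) * b u) q (volume.restrict (Ioi t))).toReal

/-- `ρ(t) = ‖u ^ (-1/q₀) b₀(u)‖_{q₀,(t,∞)} / ‖u ^ (-1/q₁) b₁(u)‖_{q₁,(t,∞)}`. -/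
def rho (q₀ q₁ : ℝ) (b₀ b₁ : ℝ → ℝ) (t : ℝ) : ℝ :=
  tailNorm q₀ b₀ t / tailNorm q₁ b₁ t

/-- `ρ_ε(t) = ‖u ^ (-1/q₀) b₀(u)‖_{q₀,(t,∞)} ^ (1+ε) / ‖u ^ (-1/q₁) b₁(u)‖_{q₁,(t,∞)}`. -/
def rhoEps (ε q₀ q₁ : ℝ) (b₀ b₁ : ℝ → ℝ) (t : ℝ) : ℝ :=
  tailNorm q₀ b₀ t ^ (1 + ε) / tailNorm q₁ b₁ t

/-- For some `ε > 0`, the function `ρ_ε` is equivalent to a non-decreasing function. -/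
def RhoCondition (q₀ q₁ : ℝ) (b₀ b₁ : ℝ → ℝ) : Prop :=
  ∃ ε : ℝ, 0 < ε ∧ ∃ g : ℝ → ℝ, MonotoneOn g (Ioi 0) ∧ EquivPos (rhoEps ε q₀ q₁ b₀ b₁) g

/-- The weight `b̃` of the interpolated space. -/
def bTilde (θ q q₀ q₁ : ℝ) (b b₀ b₁ : ℝ → ℝ) (t : ℝ) : ℝ :=
  rho q₀ q₁ b₀ b₁ t ^ (1 - θ) * b (rho q₀ q₁ b₀ b₁ t) * b₁ t ^ (q₁ / q) *
    (∫ u in Ioi t, b₁ u ^ q₁ / u) ^ (1 / q₁ - 1 / q)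

/-! ### The `K`-method for spaces `A₀, A₁ ⊆ V` with semi-quasi-norms `N₀, N₁` -/

section KMethod

variable {V : Type*} [AddCommGroup V]

/-- `K(t, f; A₀, A₁)`, equal to `∞` if `f ∉ A₀ + A₁`. -/
def kFunctional (A₀ A₁ : Set V) (N₀ N₁ : V → ℝ≥0∞) (t : ℝ) (f : V) : ℝ≥0∞ :=
  ⨅ (f₀ ∈ A₀) (f₁ ∈ A₁) (_ : f = f₀ + f₁), N₀ f₀ + ENNReal.ofReal t * N₁ f₁

/-- The semi-quasi-norm `‖t ^ (-θ-1/q) b(t) K(t, f; A₀, A₁)‖_{q,(0,∞)}`. -/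
def kInterpNorm (A₀ A₁ : Set V) (N₀ N₁ : V → ℝ≥0∞) (θ q : ℝ) (b : ℝ → ℝ) (f : V) : ℝ≥0∞ :=
  eLpNorm' (fun t : ℝ => ENNReal.ofReal (t ^ (-θ - 1 / q) * b t) * kFunctional A₀ A₁ N₀ N₁ t f)
    q (volume.restrict (Ioi 0))

/-- The `K`-interpolation space `(A₀, A₁)_{θ,q;b}`. -/
def kInterpSpace (A₀ A₁ : Set V) (N₀ N₁ : V → ℝ≥0∞) (θ q : ℝ) (b : ℝ → ℝ) : Set V :=
  {f | f ∈ A₀ + A₁ ∧ kInterpNorm A₀ A₁ N₀ N₁ θ q b f < ∞}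

end KMethod

/-! ### Rearrangement-invariant Banach function spaces on `ℝⁿ` -/

/-- A rearrangement-invariant Banach function norm on `ℝⁿ` with Lebesgue measure, in the sense of
Bennett and Sharpley: a functional on the nonnegative extended-valued measurable functions
(its values at non-measurable functions play no role). -/
structure RIFunctionNorm (n : ℕ) where
  toFun : (EuclideanSpace ℝ (Fin n) → ℝ≥0∞) → ℝ≥0∞
  eq_zero_iff : ∀ f, AEMeasurable f volume → (toFun f = 0 ↔ f =ᵐ[volume] 0)
  const_mul : ∀ (a : ℝ≥0) (f), AEMeasurable f volume →
    toFun (fun x => (a : ℝ≥0∞) * f x) = (a : ℝ≥0∞) * toFun f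
  add_le : ∀ f g, AEMeasurable f volume → AEMeasurable g volume →
    toFun (fun x => f x + g x) ≤ toFun f + toFun g
  mono : ∀ f g, AEMeasurable f volume → AEMeasurable g volume →
    f ≤ᵐ[volume] g → toFun f ≤ toFun g
  fatou : ∀ f : ℕ → EuclideanSpace ℝ (Fin n) → ℝ≥0∞, (∀ k, AEMeasurable (f k) volume) →
    (∀ᵐ x ∂volume, Monotone fun k => f k x) → toFun (fun x => ⨆ k, f k x) = ⨆ k, toFun (f k)
  indicator_lt_top : ∀ S : Set (EuclideanSpace ℝ (Fin n)), MeasurableSet S → volume S < ∞ →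
    toFun (S.indicator fun _ => 1) < ∞
  lintegral_le : ∀ S : Set (EuclideanSpace ℝ (Fin n)), MeasurableSet S → volume S < ∞ →
    ∃ C : ℝ≥0, ∀ f, AEMeasurable f volume → ∫⁻ x in S, f x ≤ C * toFun f
  rearrangement_invariant : ∀ f g, AEMeasurable f volume → AEMeasurable g volume →
    (∀ᵐ x ∂volume, f x < ∞) → (∀ᵐ x ∂volume, g x < ∞) →
    (∀ s : ℝ≥0, volume {x | (s : ℝ≥0∞) < f x} = volume {x | (s : ℝ≥0∞) < g x}) →
    toFun f = toFun g

section Besov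

variable {n : ℕ} {𝕜 : Type*} [RCLike 𝕜]

/-- The space `E` of (classes of) measurable functions determined by the norm. -/
def RIFunctionNorm.space (E : RIFunctionNorm n) (𝕜 : Type*) [RCLike 𝕜] :
    Set (EuclideanSpace ℝ (Fin n) →ₘ[volume] 𝕜) :=
  {f | E.toFun (fun x => ‖f x‖ₑ) < ∞}

/-- The modulus of continuity `ω_E(f, t) = sup_{|h| ≤ t} ‖f(· + h) - f‖_E`. -/
def modulus (E : RIFunctionNorm n) (f : EuclideanSpace ℝ (Fin n) →ₘ[volume] 𝕜) (t : ℝ) : ℝ≥0∞ :=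
  ⨆ (h : EuclideanSpace ℝ (Fin n)) (_ : ‖h‖ ≤ t), E.toFun fun x => ‖f (x + h) - f x‖ₑ

/-- The semi-quasi-norm `‖t ^ (-1/q) b(t) ω_E(f, t)‖_{q,(0,∞)}`. -/
def besovNorm (E : RIFunctionNorm n) (q : ℝ) (b : ℝ → ℝ)
    (f : EuclideanSpace ℝ (Fin n) →ₘ[volume] 𝕜) : ℝ≥0∞ :=
  eLpNorm' (fun t : ℝ => ENNReal.ofReal (t ^ (-(1 / q)) * b t) * modulus E f t)
    q (volume.restrict (Ioi 0))

/-- The homogeneous Besov space `B^{0,b}_{E,q}`. -/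
def besovSpace (E : RIFunctionNorm n) (𝕜 : Type*) [RCLike 𝕜] (q : ℝ) (b : ℝ → ℝ) :
    Set (EuclideanSpace ℝ (Fin n) →ₘ[volume] 𝕜) :=
  {f | f ∈ E.space 𝕜 ∧ besovNorm E q b f < ∞}

end Besov

end LimitingInterpolation

end

/-! Write `T_j(t)` for `tailNorm q_j b_j t`, so that `T_0 = ρ T_1`, and `ω` for the modulus of `f`.
The proof is a discretised Holmstedt formula for `K(ρ(t), f)`.

Lower bound: as moduli are non-decreasing, `T_j(t) ω(f_j, t) ≤ ‖f_j‖` for both parts of any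
splitting of `f`, and `T_0 = ρ T_1` turns this into `T_0(t) ω(t) ≤ K(ρ(t), f)`
(`tailNorm_mul_modulus_le_kFunctional`).

Upper bound: averaging `f` at scale `t` against a Lipschitz kernel gives `f = f_0 + f_1`, where
`ω(f_0, u)` is at most twice both `ω(u)` and `ω(t)`, while `ω(f_1, u)` is at most `ω(u)` and, for `u
≤ t`, at most `C (u/t) ω(t)` (`exists_decomposition`). Hence `K(ρ(t), f)` is controlled by the
`q_0`-integral of `ω` over `(0, t)`, the term `T_0(t) ω(t)`, and `ρ(t)` times the `q_1`-integral
over `(t, ∞)` (`exists_kFunctional_le`). The averaging needs a Minkowski integral inequality in `E`,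
which is drawn from the Fatou property by random sampling.

Discretisation: choose `t_k` with `ρ(t_k) = 2 ^ k` (`nonempty_dyadicScale`). From `t_k` to `t_{k+1}`
the tail `T_1` at least halves, because `T_0` does not increase, and drops by at most a constant
factor, because of the condition on `ρ_ε`. So each block carries a fixed proportion of the mass
`T_1(t_k) ^ q₁`, and the Besov norm with weight `b̃` becomes the `ℓ^q` norm of `2 ^ (k(1-θ)) b(2 ^
k) T_1(t_k) ω(t_k) = 2 ^ (-kθ) b(2 ^ k) T_0(t_k) ω(t_k)`. The interpolation norm becomes the `ℓ^q`
norm of `2 ^ (-kθ) b(2 ^ k) K(2 ^ k, f)`. The lower bound compares these term by term; the upper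
bound involves sums over the blocks on either side of `t_k`, which a discrete Hardy inequality
removes because `0 < θ < 1` (`tsum_weighted_hardy`). -/

namespace LimitingInterpolation

/-! ### Function norms: Fatou, Minkowski and the modulus of continuity -/

section FunctionNorm

variable {n : ℕ} (E : RIFunctionNorm n)

theorem RIFunctionNorm.congr_ae {f g : EuclideanSpace ℝ (Fin n) → ℝ≥0∞}
    (hf : AEMeasurable f volume) (h : f =ᵐ[volume] g) : E.toFun f = E.toFun g :=
  le_antisymm (E.mono f g hf (hf.congr h) h.le) (E.mono g f (hf.congr h) hf h.symm.le)

theorem RIFunctionNorm.toFun_zero : E.toFun (fun _ => 0) = 0 :=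
  (E.eq_zero_iff _ aemeasurable_const).2 (Eventually.of_forall fun _ => rfl)

theorem RIFunctionNorm.toFun_sum_le {ι : Type*} (s : Finset ι)
    (g : ι → EuclideanSpace ℝ (Fin n) → ℝ≥0∞) (hg : ∀ i, AEMeasurable (g i) volume) :
    E.toFun (fun x => ∑ i ∈ s, g i x) ≤ ∑ i ∈ s, E.toFun (g i) := by
  classical
  induction s using Finset.induction_on with
  | empty => simp [E.toFun_zero]
  | insert a s ha ih =>
    simp only [Finset.sum_insert ha]
    exact (E.add_le _ _ (hg a) (Finset.aemeasurable_fun_sum _ fun i _ => hg i)).trans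
      (by gcongr)

/-- The axiom `fatou` treats increasing sequences only. The infima over the tails of `u` increase to
its lower limit, which is `v` almost everywhere. -/
theorem RIFunctionNorm.toFun_le_of_tendsto {u : ℕ → EuclideanSpace ℝ (Fin n) → ℝ≥0∞}
    {v : EuclideanSpace ℝ (Fin n) → ℝ≥0∞} (hu : ∀ k, AEMeasurable (u k) volume) {M : ℝ≥0∞}
    (hM : ∀ k, E.toFun (u k) ≤ M)
    (hlim : ∀ᵐ x ∂volume, Tendsto (fun k => u k x) atTop (𝓝 (v x))) : E.toFun v ≤ M := by
  have hm : ∀ k, AEMeasurable (fun x => ⨅ i, u (k + i) x) volume := fun k =>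
    AEMeasurable.iInf fun i => hu (k + i)
  have hmono : ∀ x, Monotone fun k => ⨅ i, u (k + i) x := by
    intro x k l hkl
    refine le_iInf fun i => ?_
    have hkl' : k + (l - k + i) = l + i := by omega
    exact (iInf_le _ (l - k + i)).trans (le_of_eq (by rw [hkl']))
  have hv : (fun x => ⨆ k, ⨅ i, u (k + i) x) =ᵐ[volume] v := by
    filter_upwards [hlim] with x hx
    rw [← hx.liminf_eq, liminf_eq_iSup_iInf_of_nat']
    simp [add_comm]
  rw [← E.congr_ae (AEMeasurable.iSup hm) hv, E.fatou _ hm (Eventually.of_forall hmono)]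
  exact iSup_le fun k => (E.mono _ _ (hm k) (hu k)
    (Eventually.of_forall fun x => iInf_le (fun i => u (k + i) x) 0)).trans (hM k)

theorem RIFunctionNorm.toFun_average_le {N : ℕ}
    (g : ℕ → EuclideanSpace ℝ (Fin n) → ℝ≥0∞) (hg : ∀ i, AEMeasurable (g i) volume)
    {M : ℝ≥0∞} (hM : ∀ i, E.toFun (g i) ≤ M) :
    E.toFun (fun x => ((N : ℝ≥0)⁻¹ : ℝ≥0) * ∑ i ∈ Finset.range N, g i x) ≤ M := by
  rw [E.const_mul _ _ (Finset.aemeasurable_fun_sum _ fun i _ => hg i)]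
  have h1 : E.toFun (fun x => ∑ i ∈ Finset.range N, g i x) ≤ N * M := by
    refine (E.toFun_sum_le _ g hg).trans ?_
    simpa using Finset.sum_le_card_nsmul (Finset.range N) _ M fun i _ => hM i
  rcases Nat.eq_zero_or_pos N with rfl | hN
  -- For `N = 0` the convention `0⁻¹ = 0` in `ℝ≥0` makes the average vanish.
  · simp
  · refine (mul_le_mul_right h1 _).trans (le_of_eq ?_)
    rw [← mul_assoc, ENNReal.coe_inv (by positivity), ENNReal.coe_natCast,
      ENNReal.inv_mul_cancel (by positivity) (by simp), one_mul]

/-- The Minkowski inequality for averages of bounded functions, through the strong law of large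
numbers. -/
theorem RIFunctionNorm.toFun_integral_le {H : Type*} [MeasurableSpace H] (ν : Measure H)
    [IsProbabilityMeasure ν] (G : EuclideanSpace ℝ (Fin n) → H → ℝ)
    (hG : Measurable (Function.uncurry G)) (hG0 : ∀ x h, 0 ≤ G x h) {B : ℝ}
    (hB : ∀ x h, G x h ≤ B) {M : ℝ≥0∞}
    (hM : ∀ᵐ h ∂ν, E.toFun (fun x => ENNReal.ofReal (G x h)) ≤ M) :
    E.toFun (fun x => ENNReal.ofReal (∫ h, G x h ∂ν)) ≤ M := by
  have hGx : ∀ x, Measurable (G x) := fun x => hG.comp measurable_prodMk_left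
  have hGh : ∀ h, Measurable fun x => G x h := fun h => hG.comp measurable_prodMk_right
  -- A point of this space is a sequence of independent samples from `ν`; sample means of `G x` tend
  -- to its integral, and the norm of a sample mean is at most `M`.
  let P : Measure (ℕ → H) := Measure.infinitePi fun _ => ν
  have hind : ∀ x, ∀ᵐ ω ∂P, Tendsto (fun N : ℕ => (∑ i ∈ Finset.range N, G x (ω i)) / N) atTop
      (𝓝 (∫ h, G x h ∂ν)) := by
    intro x
    have key := ProbabilityTheory.strong_law_ae_real (μ := P) (fun i ω => G x (ω i)) ?_ ?_ ?_
    · have hI : ∫ ω, G x (ω 0) ∂P = ∫ h, G x h ∂ν := by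
        have hmp := measurePreserving_eval_infinitePi (fun _ : ℕ => ν) 0
        rw [← hmp.map_eq, integral_map hmp.measurable.aemeasurable
          (hGx x).aestronglyMeasurable]
      rw [← hI]
      exact key
    · refine Integrable.of_bound (C := B)
        ((hGx x).comp (measurable_pi_apply 0)).aestronglyMeasurable
        (Eventually.of_forall fun ω => ?_)
      rw [Real.norm_eq_abs, abs_of_nonneg (hG0 _ _)]
      exact hB _ _
    · intro i j hij
      exact (ProbabilityTheory.iIndepFun_infinitePi (P := fun _ : ℕ => ν)
        (X := fun _ => G x) (fun _ => hGx x)).indepFun hij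
    · intro i
      have hmi := measurePreserving_eval_infinitePi (fun _ : ℕ => ν) i
      have hm0 := measurePreserving_eval_infinitePi (fun _ : ℕ => ν) 0
      have hid : ProbabilityTheory.IdentDistrib (fun ω : ℕ → H => ω i) (fun ω => ω 0) P P :=
        ⟨hmi.measurable.aemeasurable, hm0.measurable.aemeasurable,
          hmi.map_eq.trans hm0.map_eq.symm⟩
      exact hid.comp (hGx x)
  have hGI : Measurable fun x => ∫ h, G x h ∂ν :=
    hG.stronglyMeasurable.integral_prod_right.measurable
  have hset : MeasurableSet {z : EuclideanSpace ℝ (Fin n) × (ℕ → H) |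
      Tendsto (fun N : ℕ => (∑ i ∈ Finset.range N, G z.1 (z.2 i)) / N) atTop
        (𝓝 (∫ h, G z.1 h ∂ν))} := by
    refine measurableSet_tendsto_fun (fun N => ?_) (hGI.comp measurable_fst)
    refine Measurable.div_const (Finset.measurable_fun_sum _ fun i _ => ?_) _
    exact hG.comp (measurable_fst.prodMk ((measurable_pi_apply i).comp measurable_snd))
  -- The exceptional null set of `ω` depends on `x`. Fubini exchanges the quantifiers, so that one
  -- sample sequence serves almost every `x`.
  have hae := (Measure.ae_ae_comm (μ := volume) (ν := P) hset).1 (Eventually.of_forall hind)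
  have hall : ∀ᵐ ω ∂P, ∀ i, E.toFun (fun x => ENNReal.ofReal (G x (ω i))) ≤ M := by
    rw [ae_all_iff]
    intro i
    exact (measurePreserving_eval_infinitePi (fun _ : ℕ => ν) i).quasiMeasurePreserving.ae hM
  obtain ⟨ω, hω1, hω2⟩ := (hae.and hall).exists
  refine E.toFun_le_of_tendsto
    (u := fun N x => ((N : ℝ≥0)⁻¹ : ℝ≥0) * ∑ i ∈ Finset.range N, ENNReal.ofReal (G x (ω i)))
    (fun N => ?_) (fun N => ?_) ?_
  · exact ((Finset.measurable_fun_sum _ fun i _ => (hGh (ω i)).ennreal_ofReal).const_mul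
      _).aemeasurable
  · exact E.toFun_average_le _ (fun i => (hGh (ω i)).ennreal_ofReal.aemeasurable) hω2
  · filter_upwards [hω1] with x hx
    refine (ENNReal.tendsto_ofReal hx).congr fun N => ?_
    rw [div_eq_inv_mul, ENNReal.ofReal_mul (by positivity),
      ENNReal.ofReal_sum_of_nonneg fun i _ => hG0 _ _]
    congr 1
    rw [← NNReal.coe_natCast, ← NNReal.coe_inv, ENNReal.ofReal_coe_nnreal]

/-- The Minkowski integral inequality with a uniform bound. -/
theorem RIFunctionNorm.toFun_lintegral_le {H : Type*} [MeasurableSpace H] (ν : Measure H)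
    [IsFiniteMeasure ν] (g : EuclideanSpace ℝ (Fin n) → H → ℝ≥0∞)
    (hg : Measurable (Function.uncurry g)) {M : ℝ≥0∞}
    (hM : ∀ᵐ h ∂ν, E.toFun (fun x => g x h) ≤ M) :
    E.toFun (fun x => ∫⁻ h, g x h ∂ν) ≤ ν univ * M := by
  have hgh : ∀ h, Measurable fun x => g x h := fun h => hg.comp measurable_prodMk_right
  have hgx : ∀ x, Measurable (g x) := fun x => hg.comp measurable_prodMk_left
  rcases eq_or_ne ν 0 with rfl | hν
  · simp [E.toFun_zero]
  have hν0 : ν univ ≠ 0 := by simpa using hν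
  have hνt : ν univ ≠ ∞ := measure_ne_top _ _
  let c : ℝ≥0 := (ν univ).toNNReal
  have hc : (c : ℝ≥0∞) = ν univ := ENNReal.coe_toNNReal hνt
  let ν' : Measure H := (ν univ)⁻¹ • ν
  have : IsProbabilityMeasure ν' := ⟨by simp [ν', ENNReal.inv_mul_cancel hν0 hνt]⟩
  have hνν' : ν = (c : ℝ≥0∞) • ν' := by
    simp [ν', hc, smul_smul, ENNReal.mul_inv_cancel hν0 hνt]
  have hM' : ∀ᵐ h ∂ν', E.toFun (fun x => g x h) ≤ M := Measure.ae_smul_measure hM _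
  have hgI : Measurable fun x => ∫⁻ h, g x h ∂ν' := hg.lintegral_prod_right'
  have hkey : E.toFun (fun x => ∫⁻ h, g x h ∂ν') ≤ M := by
    -- The law of large numbers was applied to bounded integrands; truncation at height `k` provides
    -- them, and monotone convergence lets `k` tend to infinity.
    have hmin : ∀ k : ℕ, Measurable (Function.uncurry fun x h => min (g x h) k) := fun k =>
      hg.min measurable_const
    have htop : ∀ (k : ℕ) x h, min (g x h) (k : ℝ≥0∞) ≠ ∞ := fun k x h =>
      ne_top_of_le_ne_top (ENNReal.natCast_ne_top k) (min_le_right _ _)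
    refine E.toFun_le_of_tendsto (u := fun k x => ∫⁻ h, min (g x h) (k : ℝ≥0∞) ∂ν')
      (fun k => (hmin k).lintegral_prod_right'.aemeasurable) (fun k => ?_)
      (Eventually.of_forall fun x => ?_)
    · have h1 := E.toFun_integral_le ν' (fun x h => (min (g x h) (k : ℝ≥0∞)).toReal)
        (hmin k).ennreal_toReal (fun _ _ => ENNReal.toReal_nonneg) (B := k) (fun x h => ?_)
        (M := M) ?_
      · refine le_of_eq_of_le ?_ h1
        congr 1
        funext x
        rw [integral_toReal (((hgx x).min measurable_const).aemeasurable)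
          (Eventually.of_forall fun h => (htop k x h).lt_top), ENNReal.ofReal_toReal]
        refine ne_top_of_le_ne_top (ENNReal.natCast_ne_top k) ?_
        exact (lintegral_mono fun h => min_le_right _ _).trans (by simp)
      · exact ENNReal.toReal_le_of_le_ofReal (by positivity) (by simp)
      · filter_upwards [hM'] with h hh
        refine (E.mono _ _ ?_ (hgh h).aemeasurable (Eventually.of_forall fun x => ?_)).trans hh
        · exact ((hgh h).min measurable_const).ennreal_toReal.ennreal_ofReal.aemeasurable
        · rw [ENNReal.ofReal_toReal (htop k x h)]
          exact min_le_left _ _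
    · refine lintegral_tendsto_of_tendsto_of_monotone
        (fun k => ((hgx x).min measurable_const).aemeasurable)
        (Eventually.of_forall fun h => fun k l hkl => ?_) (Eventually.of_forall fun h => ?_)
      · exact min_le_min_left _ (by exact_mod_cast hkl)
      · have : Tendsto (fun k : ℕ => min (g x h) (k : ℝ≥0∞)) atTop (𝓝 (min (g x h) ∞)) :=
          tendsto_const_nhds.min ENNReal.tendsto_nat_nhds_top
        simpa using this
  have hrw : (fun x => ∫⁻ h, g x h ∂ν) = fun x => (c : ℝ≥0∞) * ∫⁻ h, g x h ∂ν' := by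
    funext x
    conv_lhs => rw [hνν']
    rw [lintegral_smul_measure, smul_eq_mul]
  rw [hrw, E.const_mul _ _ hgI.aemeasurable, hc]
  gcongr

variable {𝕜 : Type*} [RCLike 𝕜]

theorem measurePreserving_add_right_euclidean (h : EuclideanSpace ℝ (Fin n)) :
    MeasurePreserving (fun x => x + h) (volume : Measure (EuclideanSpace ℝ (Fin n))) volume :=
  measurePreserving_add_right volume h

/-- Translations preserve Lebesgue measure, so both functions are equimeasurable. Rearrangement
invariance enters the proof only here. -/
theorem RIFunctionNorm.toFun_translate {g : EuclideanSpace ℝ (Fin n) → 𝕜}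
    (hg : Measurable g) (h : EuclideanSpace ℝ (Fin n)) :
    E.toFun (fun x => ‖g (x + h)‖ₑ) = E.toFun (fun x => ‖g x‖ₑ) := by
  refine E.rearrangement_invariant _ _ ?_ hg.enorm.aemeasurable (by simp) (by simp) fun s => ?_
  · exact (hg.comp (measurable_add_const h)).enorm.aemeasurable
  · exact (measurePreserving_add_right_euclidean h).measure_preimage
      (measurableSet_lt measurable_const hg.enorm).nullMeasurableSet

/-- The modulus of continuity of a function may be computed with any representative. -/
theorem modulus_eq_of_ae {f : EuclideanSpace ℝ (Fin n) →ₘ[volume] 𝕜}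
    {g : EuclideanSpace ℝ (Fin n) → 𝕜} (h : f =ᵐ[volume] g) (t : ℝ) :
    modulus E f t = ⨆ (h : EuclideanSpace ℝ (Fin n)) (_ : ‖h‖ ≤ t),
      E.toFun fun x => ‖g (x + h) - g x‖ₑ := by
  unfold modulus
  refine iSup_congr fun y => iSup_congr fun _ => ?_
  have hm : Measurable f := f.measurable
  refine E.congr_ae ((hm.comp (measurable_add_const y)).sub hm).enorm.aemeasurable ?_
  filter_upwards [h, (measurePreserving_add_right_euclidean y).quasiMeasurePreserving.ae h]
    with x h1 h2
  rw [h1, h2]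

theorem norm_translate_le_modulus (f : EuclideanSpace ℝ (Fin n) →ₘ[volume] 𝕜) {t : ℝ}
    {h : EuclideanSpace ℝ (Fin n)} (hh : ‖h‖ ≤ t) :
    E.toFun (fun x => ‖f (x + h) - f x‖ₑ) ≤ modulus E f t :=
  le_iSup₂ (f := fun (h : EuclideanSpace ℝ (Fin n)) (_ : ‖h‖ ≤ t) =>
    E.toFun fun x => ‖f (x + h) - f x‖ₑ) h hh

theorem modulus_mono (f : EuclideanSpace ℝ (Fin n) →ₘ[volume] 𝕜) : Monotone (modulus E f) :=
  fun _ _ hst => iSup₂_le fun _ hh => norm_translate_le_modulus E f (hh.trans hst)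

theorem modulus_add_le (f g : EuclideanSpace ℝ (Fin n) →ₘ[volume] 𝕜) (t : ℝ) :
    modulus E (f + g) t ≤ modulus E f t + modulus E g t := by
  rw [modulus_eq_of_ae E (AEEqFun.coeFn_add f g)]
  refine iSup₂_le fun h hh => ?_
  have hf : Measurable f := f.measurable
  have hg : Measurable g := g.measurable
  have hfh := ((hf.comp (measurable_add_const h)).sub hf).enorm
  have hgh := ((hg.comp (measurable_add_const h)).sub hg).enorm
  refine le_trans ?_ ((E.add_le _ _ hfh.aemeasurable hgh.aemeasurable).trans
    (add_le_add (norm_translate_le_modulus E f hh) (norm_translate_le_modulus E g hh)))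
  refine E.mono _ _ ?_ (hfh.add hgh).aemeasurable (Eventually.of_forall fun x => ?_)
  · exact (((hf.add hg).comp (measurable_add_const h)).sub (hf.add hg)).enorm.aemeasurable
  · simp only [Pi.add_apply, add_sub_add_comm]
    exact enorm_add_le _ _

theorem modulus_le_two_mul (f : EuclideanSpace ℝ (Fin n) →ₘ[volume] 𝕜) (t : ℝ) :
    modulus E f t ≤ 2 * E.toFun (fun x => ‖f x‖ₑ) := by
  refine iSup₂_le fun h _ => ?_
  have hf : Measurable f := f.measurable
  have hfh := (hf.comp (measurable_add_const h)).enorm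
  rw [two_mul]
  nth_rewrite 1 [← E.toFun_translate hf h]
  refine le_trans (E.mono _ _ ?_ (hfh.add hf.enorm).aemeasurable
    (Eventually.of_forall fun x => ?_)) (E.add_le _ _ hfh.aemeasurable hf.enorm.aemeasurable)
  · exact ((hf.comp (measurable_add_const h)).sub hf).enorm.aemeasurable
  · exact enorm_sub_le

theorem RIFunctionNorm.add_mem_space {f g : EuclideanSpace ℝ (Fin n) →ₘ[volume] 𝕜}
    (hf : f ∈ E.space 𝕜) (hg : g ∈ E.space 𝕜) : f + g ∈ E.space 𝕜 := by
  have hfm : Measurable f := f.measurable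
  have hgm : Measurable g := g.measurable
  refine lt_of_le_of_lt ?_ (ENNReal.add_lt_top.2 ⟨hf, hg⟩)
  refine le_trans ?_ (E.add_le _ _ hfm.enorm.aemeasurable hgm.enorm.aemeasurable)
  refine E.mono _ _ (f + g).measurable.enorm.aemeasurable
    (hfm.enorm.add hgm.enorm).aemeasurable ?_
  filter_upwards [AEEqFun.coeFn_add f g] with x hx
  rw [hx]
  exact enorm_add_le _ _

theorem RIFunctionNorm.neg_mem_space {f : EuclideanSpace ℝ (Fin n) →ₘ[volume] 𝕜}
    (hf : f ∈ E.space 𝕜) : -f ∈ E.space 𝕜 := by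
  refine lt_of_eq_of_lt (E.congr_ae (-f).measurable.enorm.aemeasurable ?_) hf
  filter_upwards [AEEqFun.coeFn_neg f] with x hx
  rw [hx, Pi.neg_apply, enorm_neg]

theorem modulus_neg (f : EuclideanSpace ℝ (Fin n) →ₘ[volume] 𝕜) (t : ℝ) :
    modulus E (-f) t = modulus E f t := by
  rw [modulus_eq_of_ae E (AEEqFun.coeFn_neg f)]
  unfold modulus
  refine iSup_congr fun y => iSup_congr fun _ => ?_
  congr 1
  funext x
  rw [Pi.neg_apply, Pi.neg_apply, ← neg_sub', enorm_neg]

end FunctionNorm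

/-! ### Splitting a function at a given scale -/

section Decomposition

variable {n : ℕ} (E : RIFunctionNorm n)

/-- The weight `|p|` is absorbed into the measure, which is why the bound on `g` is needed only
where `p` does not vanish. -/
theorem RIFunctionNorm.toFun_weighted_lintegral_le {H : Type*} [MeasurableSpace H]
    (μ : Measure H) (p : H → ℝ) (hp : Measurable p) {m : ℝ≥0∞} (hm : m ≠ ∞)
    (hpm : ∫⁻ h, ‖p h‖ₑ ∂μ ≤ m) (g : EuclideanSpace ℝ (Fin n) → H → ℝ≥0∞)
    (hg : Measurable (Function.uncurry g)) {M : ℝ≥0∞}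
    (hM : ∀ h, p h ≠ 0 → E.toFun (fun x => g x h) ≤ M) :
    E.toFun (fun x => ∫⁻ h, ‖p h‖ₑ * g x h ∂μ) ≤ m * M := by
  let ν := μ.withDensity fun h => ‖p h‖ₑ
  have hν : ν univ = ∫⁻ h, ‖p h‖ₑ ∂μ := by simp [ν]
  have : IsFiniteMeasure ν := ⟨by rw [hν]; exact hpm.trans_lt hm.lt_top⟩
  have h1 := E.toFun_lintegral_le ν g hg (M := M) ((ae_withDensity_iff hp.enorm).2
    (Eventually.of_forall fun h hh => hM h (by simpa using hh)))
  rw [hν] at h1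
  refine le_of_eq_of_le ?_ (h1.trans (mul_le_mul_left hpm M))
  congr 1
  funext x
  have hgx : Measurable (g x) := hg.comp measurable_prodMk_left
  exact (lintegral_withDensity_eq_lintegral_mul μ hp.enorm hgx).symm

/-- A Lipschitz averaging kernel supported in the unit ball. -/
theorem exists_lipschitz_kernel (n : ℕ) : ∃ (p : EuclideanSpace ℝ (Fin n) → ℝ) (C : ℝ≥0),
    Continuous p ∧ (∀ h, 0 ≤ p h) ∧ (∀ h, 1 < ‖h‖ → p h = 0) ∧ Integrable p ∧ ∫ h, p h = 1 ∧
    ∀ y, ‖y‖ ≤ 1 → ∫⁻ h, ‖p (h - y) - p h‖ₑ ≤ C * ENNReal.ofReal ‖y‖ := by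
  -- The tent function is 1-Lipschitz and supported in the unit ball; dividing by its integral `Z`
  -- gives the kernel.
  let k : EuclideanSpace ℝ (Fin n) → ℝ := fun h => max 0 (1 - ‖h‖)
  have hkc : Continuous k := by fun_prop
  have hk0 : ∀ h, 0 ≤ k h := fun h => le_max_left _ _
  have hks : ∀ h, 1 < ‖h‖ → k h = 0 := fun h hh => max_eq_left (by linarith)
  have hkcs : HasCompactSupport k := by
    refine HasCompactSupport.intro (isCompact_closedBall 0 1) fun h hh => hks h ?_
    simpa using hh
  have hki : Integrable k := hkc.integrable_of_hasCompactSupport hkcs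
  have hZ : 0 < ∫ h, k h := by
    refine hkc.integral_pos_of_hasCompactSupport_nonneg_nonzero hkcs (fun h => hk0 h)
      (x := 0) ?_
    simp [k]
  obtain ⟨Z, hZe⟩ : ∃ Z, Z = ∫ h, k h := ⟨_, rfl⟩
  rw [← hZe] at hZ
  have hZi : 0 ≤ Z⁻¹ := inv_nonneg.2 hZ.le
  have hlip : ∀ y h, |k (h - y) - k h| ≤ ‖y‖ := by
    intro y h
    refine (abs_max_sub_max_le_max 0 (1 - ‖h - y‖) 0 (1 - ‖h‖)).trans ?_
    have h1 : (1 - ‖h - y‖) - (1 - ‖h‖) = ‖h‖ - ‖h - y‖ := by ring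
    rw [sub_self, abs_zero, h1]
    refine max_le (norm_nonneg _) ((abs_norm_sub_norm_le _ _).trans ?_)
    simp
  -- For `‖y‖ ≤ 1` the difference of the kernel and its translate by `y` lives in the ball of radius
  -- 2.
  let V : ℝ≥0∞ := volume (Metric.closedBall (0 : EuclideanSpace ℝ (Fin n)) 2)
  have hV : V ≠ ∞ := measure_closedBall_lt_top.ne
  refine ⟨fun h => Z⁻¹ * k h, (ENNReal.ofReal Z⁻¹ * V).toNNReal, by fun_prop,
    fun h => mul_nonneg hZi (hk0 h), fun h hh => by simp [hks h hh],
    hki.const_mul _, ?_, fun y hy => ?_⟩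
  · rw [integral_const_mul, ← hZe, inv_mul_cancel₀ hZ.ne']
  · have hpt : ∀ h, ‖Z⁻¹ * k (h - y) - Z⁻¹ * k h‖ₑ ≤
        (Metric.closedBall (0 : EuclideanSpace ℝ (Fin n)) 2).indicator
          (fun _ => ENNReal.ofReal Z⁻¹ * ENNReal.ofReal ‖y‖) h := by
      intro h
      by_cases hh : h ∈ Metric.closedBall (0 : EuclideanSpace ℝ (Fin n)) 2
      · rw [indicator_of_mem hh, ← mul_sub, enorm_mul, Real.enorm_of_nonneg hZi]
        gcongr
        rw [← ofReal_norm, Real.norm_eq_abs]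
        exact ENNReal.ofReal_le_ofReal (hlip y h)
      · have h2 : 2 < ‖h‖ := by simpa using hh
        have h3 : ‖h‖ ≤ ‖h - y‖ + ‖y‖ := by
          simpa using norm_add_le (h - y) y
        rw [hks h (by linarith), hks (h - y) (by linarith)]
        simp
    refine (lintegral_mono hpt).trans (le_of_eq ?_)
    rw [lintegral_indicator_const Metric.isClosed_closedBall.measurableSet,
      ENNReal.coe_toNNReal (ENNReal.mul_ne_top ENNReal.ofReal_ne_top hV)]
    ring

variable {𝕜 : Type*} [RCLike 𝕜]

/-- The axiom `lintegral_le`, applied to balls, makes functions of `E` locally integrable, so the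
averages below are genuine Bochner integrals. -/
theorem RIFunctionNorm.integrable_indicator_closedBall {F : EuclideanSpace ℝ (Fin n) → 𝕜}
    (hF : Measurable F) (hFE : E.toFun (fun x => ‖F x‖ₑ) < ∞) (x : EuclideanSpace ℝ (Fin n))
    (R : ℝ) : Integrable ((Metric.closedBall x R).indicator F) := by
  have hms := (Metric.isClosed_closedBall (x := x) (ε := R)).measurableSet
  rw [integrable_indicator_iff hms]
  refine ⟨hF.aestronglyMeasurable, ?_⟩
  obtain ⟨C, hC⟩ := E.lintegral_le _ hms measure_closedBall_lt_top
  exact (hC _ hF.enorm.aemeasurable).trans_lt (ENNReal.mul_lt_top ENNReal.coe_lt_top hFE)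

/-- The kernel is bounded and sees only the values of `F` in the ball of radius `τ * R` about `x`.
-/
theorem RIFunctionNorm.integrable_kernel_smul {F : EuclideanSpace ℝ (Fin n) → 𝕜}
    (hF : Measurable F) (hFE : E.toFun (fun x => ‖F x‖ₑ) < ∞)
    {p : EuclideanSpace ℝ (Fin n) → ℝ} (hp : Continuous p) {R : ℝ}
    (hpR : ∀ h, R < ‖h‖ → p h = 0) {τ : ℝ} (hτ : 0 < τ) (x : EuclideanSpace ℝ (Fin n)) :
    Integrable fun h => p h • F (x + τ • h) := by
  have h1 := ((E.integrable_indicator_closedBall hF hFE x (τ * R)).comp_add_left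
    x).comp_smul hτ.ne'
  have hcs : HasCompactSupport p := HasCompactSupport.intro (isCompact_closedBall 0 R)
    fun h hh => hpR h (by simpa using hh)
  obtain ⟨B, hB⟩ := hp.bounded_above_of_compact_support hcs
  have h2 := h1.bdd_smul B hp.aestronglyMeasurable (Eventually.of_forall hB)
  refine h2.congr (Eventually.of_forall fun h => ?_)
  rw [Pi.smul_apply']
  by_cases hh : ‖h‖ ≤ R
  · rw [indicator_of_mem]
    simp only [Metric.mem_closedBall, dist_self_add_left, norm_smul, Real.norm_eq_abs,
      abs_of_pos hτ]
    gcongr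
  · simp [hpR h (not_le.1 hh)]

/-- The average of `f` at scale `t`. -/
theorem exists_average (n : ℕ) : ∃ C : ℝ≥0, ∀ (E : RIFunctionNorm n) (𝕜 : Type*) [RCLike 𝕜],
    ∀ f ∈ E.space 𝕜, ∀ t : ℝ, 0 < t → ∃ f₁ : EuclideanSpace ℝ (Fin n) →ₘ[volume] 𝕜,
      E.toFun (fun x => ‖(f - f₁) x‖ₑ) ≤ modulus E f t ∧
      (∀ u, modulus E f₁ u ≤ modulus E f u) ∧
      (∀ u, 0 < u → u ≤ t → modulus E f₁ u ≤ C * ENNReal.ofReal (u / t) * modulus E f t) := by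
  obtain ⟨p, C, hpc, hp0, hps, hpi, hp1, hpC⟩ := exists_lipschitz_kernel n
  refine ⟨2 * C + 2, fun E 𝕜 _ f hf t ht => ?_⟩
  have hF : Measurable f := f.measurable
  -- Half the scale is used because the difference kernel `r` below is supported in `‖h‖ ≤ 2`; then
  -- `‖τ • h‖ ≤ t` and `modulus E f t` suffices.
  set τ : ℝ := t / 2 with hτdef
  have hτ : 0 < τ := by positivity
  have hinteg : ∀ x, Integrable fun h => p h • f (x + τ • h) :=
    E.integrable_kernel_smul hF hf hpc hps hτ
  have hFxh : Measurable fun z : EuclideanSpace ℝ (Fin n) × EuclideanSpace ℝ (Fin n) =>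
      f (z.1 + τ • z.2) := hF.comp (by fun_prop)
  have hpm1 : ∫⁻ h, ‖p h‖ₑ ≤ 1 := by
    have : ∫⁻ h, ‖p h‖ₑ = ENNReal.ofReal (∫ h, p h) := by
      rw [ofReal_integral_eq_lintegral_ofReal hpi (Eventually.of_forall hp0)]
      exact lintegral_congr fun h => Real.enorm_of_nonneg (hp0 h)
    rw [this, hp1, ENNReal.ofReal_one]
  let g : EuclideanSpace ℝ (Fin n) → 𝕜 := fun x => ∫ h, p h • f (x + τ • h)
  have hg : StronglyMeasurable g :=
    StronglyMeasurable.integral_prod_right' (f := fun z : EuclideanSpace ℝ (Fin n) ×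
      EuclideanSpace ℝ (Fin n) => p z.2 • f (z.1 + τ • z.2))
      (((hpc.measurable.comp measurable_snd).smul hFxh).stronglyMeasurable)
  have hgm : Measurable g := hg.measurable
  let f₁ : EuclideanSpace ℝ (Fin n) →ₘ[volume] 𝕜 := AEEqFun.mk g hg.aestronglyMeasurable
  have hf₁ : f₁ =ᵐ[volume] g := AEEqFun.coeFn_mk _ _
  have htr : ∀ y, Measurable fun x : EuclideanSpace ℝ (Fin n) => g (x + y) - g x := fun y =>
    (hgm.comp (measurable_add_const y)).sub hgm
  have hcontr : ∀ u, modulus E f₁ u ≤ modulus E f u := by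
    intro u
    rw [modulus_eq_of_ae E hf₁]
    refine iSup₂_le fun y hy => ?_
    have hb : E.toFun (fun x => ∫⁻ h, ‖p h‖ₑ * ‖f (x + τ • h + y) - f (x + τ • h)‖ₑ) ≤
        1 * modulus E f u := by
      refine E.toFun_weighted_lintegral_le volume p hpc.measurable ENNReal.one_ne_top hpm1
        (fun x h => ‖f (x + τ • h + y) - f (x + τ • h)‖ₑ) (Measurable.enorm
          ((hF.comp (by fun_prop)).sub hFxh)) fun h _ => ?_
      exact (E.toFun_translate ((hF.comp (measurable_add_const y)).sub hF) (τ • h)).le.trans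
        (norm_translate_le_modulus E f hy)
    rw [one_mul] at hb
    refine le_trans (E.mono _ _ (htr y).enorm.aemeasurable ?_
      (Eventually.of_forall fun x => ?_)) hb
    · exact (Measurable.lintegral_prod_right' (f := fun z : EuclideanSpace ℝ (Fin n) ×
        EuclideanSpace ℝ (Fin n) => ‖p z.2‖ₑ * ‖f (z.1 + τ • z.2 + y) - f (z.1 + τ • z.2)‖ₑ)
        ((hpc.measurable.comp measurable_snd).enorm.mul (Measurable.enorm
          ((hF.comp (by fun_prop)).sub hFxh)))).aemeasurable
    · have hsub : g (x + y) - g x = ∫ h, p h • (f (x + τ • h + y) - f (x + τ • h)) := by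
        simp_rw [smul_sub, add_right_comm x _ y]
        rw [integral_sub (hinteg (x + y)) (hinteg x)]
      dsimp only
      rw [hsub]
      refine (enorm_integral_le_lintegral_enorm _).trans (lintegral_mono fun h => ?_)
      rw [enorm_smul]
  refine ⟨f₁, ?_, hcontr, fun u hu hut => ?_⟩
  · have hb : E.toFun (fun x => ∫⁻ h, ‖p h‖ₑ * ‖f (x + τ • h) - f x‖ₑ) ≤ 1 * modulus E f t := by
      refine E.toFun_weighted_lintegral_le volume p hpc.measurable ENNReal.one_ne_top hpm1
        (fun x h => ‖f (x + τ • h) - f x‖ₑ) ((hFxh.sub (hF.comp measurable_fst)).enorm)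
        fun h hh => norm_translate_le_modulus E f ?_
      have : ‖h‖ ≤ 1 := not_lt.1 fun hlt => hh (hps h hlt)
      rw [norm_smul, Real.norm_eq_abs, abs_of_pos hτ]
      nlinarith
    rw [one_mul] at hb
    refine le_trans (E.mono _ _ (f - f₁).measurable.enorm.aemeasurable ?_ ?_) hb
    · exact (Measurable.lintegral_prod_right' (f := fun z : EuclideanSpace ℝ (Fin n) ×
        EuclideanSpace ℝ (Fin n) => ‖p z.2‖ₑ * ‖f (z.1 + τ • z.2) - f z.1‖ₑ)
        ((hpc.measurable.comp measurable_snd).enorm.mul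
          (hFxh.sub (hF.comp measurable_fst)).enorm)).aemeasurable
    · filter_upwards [AEEqFun.coeFn_sub f f₁, hf₁] with x hx hx1
      have hsub : g x - f x = ∫ h, p h • (f (x + τ • h) - f x) := by
        simp_rw [smul_sub]
        rw [integral_sub (hinteg x) (hpi.smul_const _), integral_smul_const, hp1, one_smul]
      rw [hx, Pi.sub_apply, hx1, ← enorm_neg, neg_sub, hsub]
      refine (enorm_integral_le_lintegral_enorm _).trans (lintegral_mono fun h => ?_)
      rw [enorm_smul]
  -- A translation of `g` by `y` is moved onto the kernel, where it becomes a shift by `τ⁻¹ • y`.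
  -- The Lipschitz bound for the kernel then yields the factor `‖y‖ / τ`.
  · have hsmall : ∀ y : EuclideanSpace ℝ (Fin n), ‖y‖ ≤ τ →
        E.toFun (fun x => ‖g (x + y) - g x‖ₑ) ≤
          C * ENNReal.ofReal (‖y‖ / τ) * modulus E f t := by
      intro y hy
      have hy' : ‖τ⁻¹ • y‖ = ‖y‖ / τ := by
        rw [norm_smul, Real.norm_eq_abs, abs_of_pos (inv_pos.2 hτ), div_eq_inv_mul]
      have hy1 : ‖τ⁻¹ • y‖ ≤ 1 := by rw [hy']; exact (div_le_one hτ).2 hy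
      let r : EuclideanSpace ℝ (Fin n) → ℝ := fun h => p (h - τ⁻¹ • y) - p h
      have hrc : Continuous r := by fun_prop
      have hpys : ∀ h, 2 < ‖h‖ → p (h - τ⁻¹ • y) = 0 := by
        intro h hh
        refine hps _ ?_
        have h3 : ‖h‖ ≤ ‖h - τ⁻¹ • y‖ + ‖τ⁻¹ • y‖ := by
          simpa using norm_add_le (h - τ⁻¹ • y) (τ⁻¹ • y)
        linarith
      have hrs : ∀ h, 2 < ‖h‖ → r h = 0 := fun h hh => by
        simp only [r]
        rw [hpys h hh, hps h (by linarith), sub_zero]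
      have hb : E.toFun (fun x => ∫⁻ h, ‖r h‖ₑ * ‖f (x + τ • h) - f x‖ₑ) ≤
          C * ENNReal.ofReal ‖τ⁻¹ • y‖ * modulus E f t := by
        refine E.toFun_weighted_lintegral_le volume r hrc.measurable
          (ENNReal.mul_ne_top ENNReal.coe_ne_top ENNReal.ofReal_ne_top) (hpC _ hy1)
          (fun x h => ‖f (x + τ • h) - f x‖ₑ) ((hFxh.sub (hF.comp measurable_fst)).enorm)
          fun h hh => norm_translate_le_modulus E f ?_
        have : ‖h‖ ≤ 2 := not_lt.1 fun hlt => hh (hrs h hlt)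
        rw [norm_smul, Real.norm_eq_abs, abs_of_pos hτ]
        nlinarith
      rw [hy'] at hb
      refine le_trans (E.mono _ _ (htr y).enorm.aemeasurable ?_
        (Eventually.of_forall fun x => ?_)) hb
      · exact (Measurable.lintegral_prod_right' (f := fun z : EuclideanSpace ℝ (Fin n) ×
          EuclideanSpace ℝ (Fin n) => ‖r z.2‖ₑ * ‖f (z.1 + τ • z.2) - f z.1‖ₑ)
          ((hrc.measurable.comp measurable_snd).enorm.mul
            (hFxh.sub (hF.comp measurable_fst)).enorm)).aemeasurable
      · have hpyc : Continuous fun h => p (h - τ⁻¹ • y) := by fun_prop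
        have hshift : g (x + y) = ∫ h, p (h - τ⁻¹ • y) • f (x + τ • h) := by
          rw [← integral_add_right_eq_self _ (τ⁻¹ • y)]
          refine integral_congr_ae (Eventually.of_forall fun h => ?_)
          simp only [add_sub_cancel_right, smul_add, smul_inv_smul₀ hτ.ne']
          rw [add_assoc x y, add_comm y]
        -- The zero mean of `r` allows `f x` to be subtracted under the integral, so that only
        -- differences of `f` occur.
        have hrI : ∫ h, r h = 0 := by
          simp only [r]
          rw [integral_sub (hpi.comp_sub_right _) hpi, integral_sub_right_eq_self, sub_self]
        have hri : Integrable r := (hpi.comp_sub_right _).sub hpi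
        have hsub : g (x + y) - g x = ∫ h, r h • (f (x + τ • h) - f x) := by
          simp_rw [smul_sub]
          rw [integral_sub (E.integrable_kernel_smul hF hf hrc hrs hτ x) (hri.smul_const _),
            integral_smul_const, hrI, zero_smul, sub_zero, hshift]
          simp only [g, r, sub_smul]
          rw [integral_sub (E.integrable_kernel_smul hF hf hpyc hpys hτ x) (hinteg x)]
        dsimp only
        rw [hsub]
        refine (enorm_integral_le_lintegral_enorm _).trans (lintegral_mono fun h => ?_)
        rw [enorm_smul]
    have h2 : 2 * ENNReal.ofReal (u / t) = ENNReal.ofReal (2 * (u / t)) := by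
      rw [ENNReal.ofReal_mul (by norm_num), ENNReal.ofReal_ofNat]
    -- For `u > τ` the factor `2 * (u / t)` exceeds 1, and the contraction `hcontr` is enough.
    rcases le_or_gt u τ with huτ | huτ
    · rw [modulus_eq_of_ae E hf₁]
      refine iSup₂_le fun y hy => (hsmall y (hy.trans huτ)).trans ?_
      have h1 : ENNReal.ofReal (‖y‖ / τ) ≤ 2 * ENNReal.ofReal (u / t) := by
        rw [h2]
        refine ENNReal.ofReal_le_ofReal ?_
        rw [hτdef, div_div_eq_mul_div, mul_div_assoc', mul_comm]
        gcongr
      calc (C : ℝ≥0∞) * ENNReal.ofReal (‖y‖ / τ) * modulus E f t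
          ≤ C * (2 * ENNReal.ofReal (u / t)) * modulus E f t := by gcongr
        _ = (2 * C) * ENNReal.ofReal (u / t) * modulus E f t := by ring
        _ ≤ ((2 * C + 2 : ℝ≥0) : ℝ≥0∞) * ENNReal.ofReal (u / t) * modulus E f t := by
            push_cast
            gcongr
            exact le_self_add
    · have h1 : 1 ≤ 2 * ENNReal.ofReal (u / t) := by
        rw [h2, ← ENNReal.ofReal_one]
        refine ENNReal.ofReal_le_ofReal ?_
        rw [mul_div_assoc', one_le_div ht]
        linarith
      calc modulus E f₁ u ≤ 1 * modulus E f t := by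
            rw [one_mul]
            exact (hcontr u).trans (modulus_mono E f hut)
        _ ≤ (2 * ENNReal.ofReal (u / t)) * modulus E f t := by gcongr
        _ ≤ ((2 * C + 2 : ℝ≥0) : ℝ≥0∞) * ENNReal.ofReal (u / t) * modulus E f t := by
            push_cast
            gcongr
            exact le_add_self

/-- Every function of the space splits, at each scale `t`, into a small and a smooth part. -/
theorem exists_decomposition (n : ℕ) : ∃ C : ℝ≥0, ∀ (E : RIFunctionNorm n) (𝕜 : Type*)
    [RCLike 𝕜], ∀ f ∈ E.space 𝕜, ∀ t : ℝ, 0 < t →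
    ∃ f₀ ∈ E.space 𝕜, ∃ f₁ ∈ E.space 𝕜, f = f₀ + f₁ ∧
      (∀ u, modulus E f₀ u ≤ 2 * modulus E f u) ∧ (∀ u, modulus E f₀ u ≤ 2 * modulus E f t) ∧
      (∀ u, modulus E f₁ u ≤ modulus E f u) ∧
      (∀ u, 0 < u → u ≤ t → modulus E f₁ u ≤ C * ENNReal.ofReal (u / t) * modulus E f t) := by
  obtain ⟨C, hC⟩ := exists_average n
  refine ⟨C, fun E 𝕜 _ f hf t ht => ?_⟩
  obtain ⟨f₁, h0, h1, h2⟩ := hC E 𝕜 f hf t ht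
  have hf₀ : f - f₁ ∈ E.space 𝕜 :=
    (h0.trans (modulus_le_two_mul E f t)).trans_lt (ENNReal.mul_lt_top (by simp) hf)
  have hf₁ : f₁ ∈ E.space 𝕜 := by
    have := E.add_mem_space hf (E.neg_mem_space hf₀)
    simpa using this
  refine ⟨f - f₁, hf₀, f₁, hf₁, (sub_add_cancel f f₁).symm, fun u => ?_, fun u => ?_, h1, h2⟩
  · rw [sub_eq_add_neg, two_mul]
    refine (modulus_add_le E f (-f₁) u).trans ?_
    rw [modulus_neg]
    gcongr
    exact h1 u
  · refine (modulus_le_two_mul E _ u).trans ?_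
    gcongr

end Decomposition

/-! ### Slowly varying weights and their tail norms -/

section SlowlyVarying

theorem SlowlyVarying.exists_rpow_mul_le {b : ℝ → ℝ} (hb : SlowlyVarying b) {α : ℝ}
    (hα : 0 < α) : ∃ C : ℝ, 0 < C ∧ ∀ s t : ℝ, 0 < s → s ≤ t →
      s ^ α * b s ≤ C * (t ^ α * b t) := by
  obtain ⟨g, -, hgm, c, C, hc, hC, h⟩ := hb.equiv_monotone α hα
  refine ⟨C * c⁻¹, by positivity, fun s t hs hst => ?_⟩
  have ht := hs.trans_le hst
  calc s ^ α * b s ≤ C * g s := (h s hs).2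
    _ ≤ C * g t := by gcongr; exact hgm hs ht hst
    _ = C * c⁻¹ * (c * g t) := by field_simp
    _ ≤ C * c⁻¹ * (t ^ α * b t) := mul_le_mul_of_nonneg_left (h t ht).1 (by positivity)

theorem SlowlyVarying.exists_rpow_neg_mul_le {b : ℝ → ℝ} (hb : SlowlyVarying b) {α : ℝ}
    (hα : 0 < α) : ∃ C : ℝ, 0 < C ∧ ∀ s t : ℝ, 0 < s → s ≤ t →
      t ^ (-α) * b t ≤ C * (s ^ (-α) * b s) := by
  obtain ⟨g, -, hgm, c, C, hc, hC, h⟩ := hb.equiv_antitone α hα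
  refine ⟨C * c⁻¹, by positivity, fun s t hs hst => ?_⟩
  have ht := hs.trans_le hst
  calc t ^ (-α) * b t ≤ C * g t := (h t ht).2
    _ ≤ C * g s := by gcongr; exact hgm hs ht hst
    _ = C * c⁻¹ * (c * g s) := by field_simp
    _ ≤ C * c⁻¹ * (s ^ (-α) * b s) := mul_le_mul_of_nonneg_left (h s hs).1 (by positivity)

/-- The function `u ↦ b(u) ^ q / u`, with values in `[0, ∞]`. -/
noncomputable def logWeight (q : ℝ) (b : ℝ → ℝ) (u : ℝ) : ℝ≥0∞ := ENNReal.ofReal (b u ^ q / u)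

theorem rpow_neg_inv_mul_rpow {q u x : ℝ} (hq : 0 < q) (hu : 0 < u) (hx : 0 ≤ x) :
    (u ^ (-(1 / q)) * x) ^ q = x ^ q / u := by
  rw [Real.mul_rpow (by positivity) hx, ← Real.rpow_mul hu.le, neg_mul,
    one_div_mul_cancel hq.ne', Real.rpow_neg_one, div_eq_inv_mul]

theorem ofReal_weight_mul_rpow {q u x : ℝ} (hq : 0 < q) (hu : 0 < u) (hx : 0 ≤ x) (y : ℝ≥0∞) :
    (ENNReal.ofReal (u ^ (-(1 / q)) * x) * y) ^ q = ENNReal.ofReal (x ^ q / u) * y ^ q := by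
  rw [ENNReal.mul_rpow_of_nonneg _ _ hq.le,
    ENNReal.ofReal_rpow_of_nonneg (by positivity) hq.le, rpow_neg_inv_mul_rpow hq hu hx]

variable {q : ℝ} {b : ℝ → ℝ}

/-- On `(s, t]` the weight is bounded, since `u * b u` is at most a constant times `t * b t`. -/
theorem SlowlyVarying.logWeight_lintegral_Ioc_lt_top (hq : 0 < q) (hb : SlowlyVarying b) {s t : ℝ}
    (hs : 0 < s) : ∫⁻ u in Ioc s t, logWeight q b u < ∞ := by
  obtain ⟨C, hC, h⟩ := hb.exists_rpow_mul_le one_pos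
  have hle : ∀ u ∈ Ioc s t, logWeight q b u ≤ ENNReal.ofReal ((C * (t * b t) / s) ^ q / s) := by
    intro u hu
    have hu0 : 0 < u := hs.trans hu.1
    have hbu := hb.pos u hu0
    have h1 := h u t hu0 hu.2
    rw [Real.rpow_one, Real.rpow_one] at h1
    refine ENNReal.ofReal_le_ofReal ?_
    have h2 : b u ≤ C * (t * b t) / s := by
      rw [le_div_iff₀ hs]
      nlinarith [hu.1]
    have h3 := hu.1.le
    have h4 : 0 ≤ (C * (t * b t) / s) ^ q := Real.rpow_nonneg (hbu.le.trans h2) q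
    gcongr
  refine (setLIntegral_mono measurable_const hle).trans_lt ?_
  rw [setLIntegral_const]
  exact ENNReal.mul_lt_top ENNReal.ofReal_lt_top (by simp)

theorem eLpNorm'_tail_eq (hq : 0 < q) (hb : SlowlyVarying b) {t : ℝ} (ht : 0 ≤ t) :
    eLpNorm' (fun u : ℝ => u ^ (-(1 / q)) * b u) q (volume.restrict (Ioi t)) =
      (∫⁻ u in Ioi t, logWeight q b u) ^ (1 / q) := by
  rw [eLpNorm'_eq_lintegral_enorm]
  congr 1
  refine setLIntegral_congr_fun measurableSet_Ioi fun u hu => ?_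
  have hu0 : 0 < u := ht.trans_lt hu
  have hbu := hb.pos u hu0
  rw [Real.enorm_of_nonneg (by positivity),
    ENNReal.ofReal_rpow_of_nonneg (by positivity) hq.le, rpow_neg_inv_mul_rpow hq hu0 hbu.le]
  rfl

theorem SlowlyVaryingZero.logWeight_lintegral_Ioi_lt_top (hq : 0 < q) (hb : SlowlyVaryingZero q b)
    {t : ℝ} (ht : 0 < t) : ∫⁻ u in Ioi t, logWeight q b u < ∞ := by
  have h1 : ∫⁻ u in Ioi 1, logWeight q b u < ∞ := by
    have := hb.tail_lt_top
    rw [eLpNorm'_tail_eq hq hb.toSlowlyVarying zero_le_one] at this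
    exact (ENNReal.rpow_lt_top_iff_of_pos (by positivity)).1 this
  have hsub : Ioi t ⊆ Ioc t 1 ∪ Ioi 1 := fun u hu => by
    rcases le_or_gt u 1 with h | h
    · exact Or.inl ⟨hu, h⟩
    · exact Or.inr h
  refine (lintegral_mono_set hsub).trans_lt ((lintegral_union_le _ _ _).trans_lt ?_)
  exact ENNReal.add_lt_top.2 ⟨hb.logWeight_lintegral_Ioc_lt_top hq ht, h1⟩

theorem SlowlyVaryingZero.lintegral_Ioi_eq (hq : 0 < q) (hb : SlowlyVaryingZero q b)
    {t : ℝ} (ht : 0 < t) :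
    ∫⁻ u in Ioi t, logWeight q b u = ENNReal.ofReal (tailNorm q b t ^ q) := by
  have h := (hb.logWeight_lintegral_Ioi_lt_top hq ht).ne
  rw [tailNorm, eLpNorm'_tail_eq hq hb.toSlowlyVarying ht.le, ENNReal.toReal_rpow,
    ← ENNReal.rpow_mul, one_div_mul_cancel hq.ne', ENNReal.rpow_one, ENNReal.ofReal_toReal h]

theorem tailNorm_nonneg (t : ℝ) : 0 ≤ tailNorm q b t := ENNReal.toReal_nonneg

theorem SlowlyVaryingZero.tailNorm_antitone (hq : 0 < q) (hb : SlowlyVaryingZero q b)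
    {s t : ℝ} (hs : 0 < s) (hst : s ≤ t) : tailNorm q b t ≤ tailNorm q b s := by
  have h1 : ∫⁻ u in Ioi t, logWeight q b u ≤ ∫⁻ u in Ioi s, logWeight q b u :=
    lintegral_mono_set (Ioi_subset_Ioi hst)
  rw [hb.lintegral_Ioi_eq hq hs, hb.lintegral_Ioi_eq hq (hs.trans_le hst),
    ENNReal.ofReal_le_ofReal_iff (Real.rpow_nonneg (tailNorm_nonneg _) _)] at h1
  exact (Real.rpow_le_rpow_iff (tailNorm_nonneg _) (tailNorm_nonneg _) hq).1 h1

/-- A slowly varying function is dominated by its tail norm. -/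
theorem SlowlyVaryingZero.exists_le_tailNorm (hq : 0 < q) (hb : SlowlyVaryingZero q b) :
    ∃ C : ℝ, 0 < C ∧ ∀ t, 0 < t → b t ≤ C * tailNorm q b t := by
  obtain ⟨C, hC, h⟩ := hb.exists_rpow_mul_le one_pos
  refine ⟨2 * C * 2 ^ (1 / q), by positivity, fun t ht => ?_⟩
  have hbt := hb.pos t ht
  -- Almost monotonicity of `u * b u` loses a factor `2 * C` on `(t, 2t]`. The length `t` against
  -- the density `1 / (2t)` loses another `1/2`, hence the `2 ^ (1 / q)` in the constant.
  have hle : ∀ u ∈ Ioc t (2 * t), ENNReal.ofReal ((b t / (2 * C)) ^ q / (2 * t)) ≤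
      logWeight q b u := by
    intro u hu
    have hu0 : 0 < u := ht.trans hu.1
    have hbu := hb.pos u hu0
    have h1 := h t u ht hu.1.le
    rw [Real.rpow_one, Real.rpow_one] at h1
    refine ENNReal.ofReal_le_ofReal ?_
    have h2 : b t / (2 * C) ≤ b u := by
      rw [div_le_iff₀ (by positivity)]
      have : t * b t ≤ t * (b u * (2 * C)) := by
        refine h1.trans ?_
        have := mul_le_mul_of_nonneg_right hu.2 (mul_pos hC hbu).le
        linarith
      exact le_of_mul_le_mul_left this ht
    have h3 := hu.2
    gcongr
  have h1 : ENNReal.ofReal ((b t / (2 * C)) ^ q / (2 * t)) * ENNReal.ofReal t ≤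
      ENNReal.ofReal (tailNorm q b t ^ q) := by
    rw [← hb.lintegral_Ioi_eq hq ht]
    refine le_trans ?_ (lintegral_mono_set (Ioc_subset_Ioi_self : Ioc t (2 * t) ⊆ Ioi t))
    refine le_trans (le_of_eq ?_) (setLIntegral_mono' measurableSet_Ioc hle)
    rw [setLIntegral_const, Real.volume_Ioc]
    congr 2
    ring
  rw [← ENNReal.ofReal_mul (by positivity),
    ENNReal.ofReal_le_ofReal_iff (Real.rpow_nonneg (tailNorm_nonneg _) _)] at h1
  have h2 : (b t / (2 * C * 2 ^ (1 / q))) ^ q ≤ tailNorm q b t ^ q := by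
    refine le_trans (le_of_eq ?_) h1
    rw [← div_div, Real.div_rpow (by positivity) (by positivity), ← Real.rpow_mul (by norm_num),
      one_div_mul_cancel hq.ne', Real.rpow_one]
    field_simp
  have h3 := (Real.rpow_le_rpow_iff (by positivity) (tailNorm_nonneg _) hq).1 h2
  rwa [div_le_iff₀ (by positivity), mul_comm] at h3

theorem SlowlyVaryingZero.tailNorm_pos (hq : 0 < q) (hb : SlowlyVaryingZero q b) {t : ℝ}
    (ht : 0 < t) : 0 < tailNorm q b t := by
  obtain ⟨C, hC, h⟩ := hb.exists_le_tailNorm hq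
  exact pos_of_mul_pos_right ((hb.pos t ht).trans_le (h t ht)) hC.le

theorem SlowlyVarying.logWeight_aemeasurable (hb : SlowlyVarying b) :
    AEMeasurable (logWeight q b) (volume.restrict (Ioi 0)) :=
  ((hb.aemeasurable.pow_const q).div aemeasurable_id).ennreal_ofReal

theorem SlowlyVaryingZero.lintegral_Ioc_add (hq : 0 < q) (hb : SlowlyVaryingZero q b)
    {s t : ℝ} (hs : 0 < s) (hst : s ≤ t) :
    (∫⁻ u in Ioc s t, logWeight q b u) + ENNReal.ofReal (tailNorm q b t ^ q) =
      ENNReal.ofReal (tailNorm q b s ^ q) := by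
  rw [← hb.lintegral_Ioi_eq hq hs, ← hb.lintegral_Ioi_eq hq (hs.trans_le hst),
    ← Ioc_union_Ioi_eq_Ioi hst, lintegral_union measurableSet_Ioi (Ioc_disjoint_Ioi le_rfl)]

theorem SlowlyVaryingZero.lintegral_Ioc_eq (hq : 0 < q) (hb : SlowlyVaryingZero q b)
    {s t : ℝ} (hs : 0 < s) (hst : s ≤ t) :
    ∫⁻ u in Ioc s t, logWeight q b u =
      ENNReal.ofReal (tailNorm q b s ^ q - tailNorm q b t ^ q) := by
  rw [ENNReal.ofReal_sub _ (Real.rpow_nonneg (tailNorm_nonneg _) _),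
    ← hb.lintegral_Ioc_add hq hs hst]
  exact (ENNReal.add_sub_cancel_right ENNReal.ofReal_ne_top).symm

theorem SlowlyVaryingZero.setIntegral_Ioi_eq (hq : 0 < q) (hb : SlowlyVaryingZero q b)
    {t : ℝ} (ht : 0 < t) : ∫ u in Ioi t, b u ^ q / u = tailNorm q b t ^ q := by
  have hm : AEStronglyMeasurable (fun u => b u ^ q / u) (volume.restrict (Ioi t)) :=
    (((hb.aemeasurable.pow_const q).div aemeasurable_id).aestronglyMeasurable).mono_measure
      (Measure.restrict_mono (Ioi_subset_Ioi ht.le) le_rfl)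
  rw [integral_eq_lintegral_of_nonneg_ae _ hm]
  · have := hb.lintegral_Ioi_eq hq ht
    unfold logWeight at this
    rw [this, ENNReal.toReal_ofReal (Real.rpow_nonneg (tailNorm_nonneg _) _)]
  · refine (ae_restrict_iff' measurableSet_Ioi).2 (Eventually.of_forall fun u hu => ?_)
    have hu0 : 0 < u := ht.trans hu
    have := hb.pos u hu0
    simp only [Pi.zero_apply]
    positivity

/-- Continuity is what lets `ρ` attain every positive value, by the intermediate value theorem. -/
theorem SlowlyVaryingZero.continuousOn_tailNorm (hq : 0 < q) (hb : SlowlyVaryingZero q b) :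
    ContinuousOn (tailNorm q b) (Ioi 0) := by
  have hpow : ContinuousOn (fun t => ∫ u in Ioi t, b u ^ q / u) (Ioi 0) := by
    intro t ht
    have ht0 : 0 < t := ht
    have hinteg : IntegrableOn (fun u => b u ^ q / u) (Ioi (t / 2)) := by
      -- A non-integrable function would have Bochner integral 0, while this integral is a power of
      -- a positive tail norm.
      by_contra hcon
      have h1 := hb.setIntegral_Ioi_eq hq (half_pos ht0)
      rw [integral_undef hcon] at h1
      exact (Real.rpow_pos_of_pos (hb.tailNorm_pos hq (half_pos ht0)) q).ne h1
    have hc : ContinuousAt (fun x => ∫ u in Ioi x, b u ^ q / u) t := by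
      have hcI : ContinuousOn (fun x => ∫ u in (t / 2)..x, b u ^ q / u) (Icc (t / 2) (2 * t)) := by
        have := intervalIntegral.continuousOn_primitive_interval (μ := volume)
          (f := fun u => b u ^ q / u) (a := t / 2) (b := 2 * t) ?_
        · rwa [uIcc_of_le (by linarith)] at this
        · rw [uIcc_of_le (by linarith)]
          exact (integrableOn_Icc_iff_integrableOn_Ioc).2 (hinteg.mono_set Ioc_subset_Ioi_self)
      have hcA := hcI.continuousAt (Icc_mem_nhds (by linarith) (by linarith) : _ ∈ 𝓝 t)
      refine ((continuousAt_const (y := ∫ u in Ioi (t / 2), b u ^ q / u)).sub hcA).congr ?_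
      filter_upwards [Ioi_mem_nhds (show t / 2 < t by linarith)] with x hx
      have hx' : t / 2 ≤ x := le_of_lt hx
      rw [Pi.sub_apply, intervalIntegral.integral_of_le hx', ← Ioc_union_Ioi_eq_Ioi hx',
        setIntegral_union (Ioc_disjoint_Ioi le_rfl) measurableSet_Ioi
          (hinteg.mono_set Ioc_subset_Ioi_self) (hinteg.mono_set (Ioi_subset_Ioi hx'))]
      exact add_sub_cancel_left _ _
    exact hc.continuousWithinAt
  refine (hpow.rpow_const (p := 1 / q) fun t _ => Or.inr (by positivity)).congr fun t ht => ?_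
  dsimp only
  rw [hb.setIntegral_Ioi_eq hq ht, ← Real.rpow_mul (tailNorm_nonneg _),
    mul_one_div_cancel hq.ne', Real.rpow_one]

/-- Hardy-type estimate near the origin. -/
theorem SlowlyVaryingZero.exists_lintegral_Ioc_zero_le (hq : 0 < q) (hb : SlowlyVaryingZero q b) :
    ∃ C : ℝ≥0, ∀ t, 0 < t → ∫⁻ u in Ioc 0 t, logWeight q b u * ENNReal.ofReal (u / t) ^ q ≤
      C * ENNReal.ofReal (tailNorm q b t ^ q) := by
  -- Half of the factor `u / t` controls `b u` by `b t`; the other half leaves `u ^ (q / 2 - 1)`,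
  -- which is integrable at 0.
  obtain ⟨C, hC, h⟩ := hb.exists_rpow_mul_le (α := 1 / 2) (by norm_num)
  obtain ⟨C', hC', h'⟩ := hb.exists_le_tailNorm hq
  refine ⟨((C * C') ^ q * (2 / q)).toNNReal, fun t ht => ?_⟩
  have hbt := hb.pos t ht
  have hT := tailNorm_nonneg (q := q) (b := b) t
  have hle : ∀ u ∈ Ioc 0 t, logWeight q b u * ENNReal.ofReal (u / t) ^ q ≤
      ENNReal.ofReal ((C * b t) ^ q * t ^ (-(q / 2)) * u ^ (q / 2 - 1)) := by
    intro u hu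
    have hu0 : 0 < u := hu.1
    have hbu := hb.pos u hu0
    have h1 := h u t hu0 hu.2
    have h2 : b u * (u / t) ≤ C * b t * (t ^ (-(1 / 2) : ℝ) * u ^ (1 / 2 : ℝ)) := by
      have e1 : u = u ^ (1 / 2 : ℝ) * u ^ (1 / 2 : ℝ) := by
        rw [← Real.rpow_add hu0]; norm_num
      have e2 : t ^ (1 / 2 : ℝ) / t = t ^ (-(1 / 2) : ℝ) := by
        nth_rewrite 2 [← Real.rpow_one t]
        rw [← Real.rpow_sub ht]; norm_num
      calc b u * (u / t) = (u ^ (1 / 2 : ℝ) * b u) * (u ^ (1 / 2 : ℝ) / t) := by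
            nth_rewrite 2 [e1]; ring
        _ ≤ C * (t ^ (1 / 2 : ℝ) * b t) * (u ^ (1 / 2 : ℝ) / t) := by gcongr
        _ = C * b t * ((t ^ (1 / 2 : ℝ) / t) * u ^ (1 / 2 : ℝ)) := by ring
        _ = _ := by rw [e2]
    rw [logWeight, ENNReal.ofReal_rpow_of_nonneg (by positivity) hq.le,
      ← ENNReal.ofReal_mul (by positivity)]
    refine ENNReal.ofReal_le_ofReal ?_
    calc b u ^ q / u * (u / t) ^ q = (b u * (u / t)) ^ q / u := by
          rw [Real.mul_rpow hbu.le (by positivity)]; ring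
      _ ≤ (C * b t * (t ^ (-(1 / 2) : ℝ) * u ^ (1 / 2 : ℝ))) ^ q / u := by gcongr
      _ = _ := by
          rw [Real.mul_rpow (x := C * b t) (by positivity) (by positivity),
            Real.mul_rpow (x := t ^ (-(1 / 2) : ℝ)) (by positivity) (by positivity),
            ← Real.rpow_mul ht.le,
            ← Real.rpow_mul hu0.le, Real.rpow_sub hu0, Real.rpow_one]
          rw [show -(1 / 2) * q = -(q / 2) by ring, show 1 / 2 * q = q / 2 by ring]
          ring
  refine (setLIntegral_mono' measurableSet_Ioc hle).trans ?_
  have hinteg : IntegrableOn (fun u : ℝ => u ^ (q / 2 - 1)) (Ioc 0 t) := by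
    have := intervalIntegral.intervalIntegrable_rpow' (a := 0) (b := t) (r := q / 2 - 1)
      (by linarith)
    exact (intervalIntegrable_iff_integrableOn_Ioc_of_le ht.le).1 this
  have hI : ∫⁻ u in Ioc 0 t, ENNReal.ofReal (u ^ (q / 2 - 1)) =
      ENNReal.ofReal (t ^ (q / 2) / (q / 2)) := by
    rw [← ofReal_integral_eq_lintegral_ofReal hinteg, ← intervalIntegral.integral_of_le ht.le,
      integral_rpow (Or.inl (by linarith))]
    · congr 1
      rw [sub_add_cancel, Real.zero_rpow (by positivity), sub_zero]
    · refine (ae_restrict_iff' measurableSet_Ioc).2 (Eventually.of_forall fun u hu => ?_)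
      exact Real.rpow_nonneg hu.1.le _
  have hcm : ∀ u, ENNReal.ofReal ((C * b t) ^ q * t ^ (-(q / 2)) * u ^ (q / 2 - 1)) =
      ENNReal.ofReal ((C * b t) ^ q * t ^ (-(q / 2))) * ENNReal.ofReal (u ^ (q / 2 - 1)) :=
    fun u => ENNReal.ofReal_mul (by positivity)
  simp_rw [hcm]
  rw [lintegral_const_mul' _ _ ENNReal.ofReal_ne_top, hI, ← ENNReal.ofReal_mul (by positivity)]
  change _ ≤ ENNReal.ofReal _ * ENNReal.ofReal _
  rw [← ENNReal.ofReal_mul (by positivity)]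
  refine ENNReal.ofReal_le_ofReal ?_
  have e3 : t ^ (-(q / 2)) * t ^ (q / 2) = 1 := by rw [← Real.rpow_add ht]; simp
  calc (C * b t) ^ q * t ^ (-(q / 2)) * (t ^ (q / 2) / (q / 2))
      = (C * b t) ^ q * (2 / q) * (t ^ (-(q / 2)) * t ^ (q / 2)) := by field_simp
    _ = (C * b t) ^ q * (2 / q) := by rw [e3, mul_one]
    _ ≤ (C * (C' * tailNorm q b t)) ^ q * (2 / q) := by
        gcongr
        exact h' t ht
    _ = (C * C') ^ q * (2 / q) * tailNorm q b t ^ q := by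
        rw [← mul_assoc, Real.mul_rpow (by positivity) hT]; ring

end SlowlyVarying

/-! ### Block decompositions of integrals and a discrete Hardy inequality -/

section Sequences

theorem lintegral_Ioi_eq_tsum_Ioc {a : ℤ → ℝ} (ha : Monotone a) (hpos : ∀ k, 0 < a k)
    (hcover : ∀ x, 0 < x → ∃ k, x ∈ Ioc (a k) (a (k + 1))) (g : ℝ → ℝ≥0∞) :
    ∫⁻ u in Ioi 0, g u = ∑' k : ℤ, ∫⁻ u in Ioc (a k) (a (k + 1)), g u := by
  have hU : Ioi (0 : ℝ) = ⋃ k : ℤ, Ioc (a k) (a (k + 1)) := by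
    ext x
    simp only [mem_Ioi, mem_iUnion]
    exact ⟨hcover x, fun ⟨k, hk⟩ => (hpos k).trans hk.1⟩
  rw [hU, lintegral_iUnion (fun k => measurableSet_Ioc)]
  exact ha.pairwise_disjoint_on_Ioc_succ

theorem lintegral_Ioc_zero_le_tsum {a : ℤ → ℝ} (ha : Monotone a)
    (hcover : ∀ x, 0 < x → ∃ k, x ∈ Ioc (a k) (a (k + 1))) (g : ℝ → ℝ≥0∞) (k : ℤ) :
    ∫⁻ u in Ioc 0 (a k), g u ≤ ∑' i : ℕ, ∫⁻ u in Ioc (a (k - i - 1)) (a (k - i)), g u := by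
  refine (lintegral_mono_set fun x hx => ?_).trans (lintegral_iUnion_le _ _)
  obtain ⟨j, hj⟩ := hcover x hx.1
  have hjk : j < k := ha.reflect_lt (hj.1.trans_le hx.2)
  have e : k - ((k - 1 - j).toNat : ℤ) = j + 1 := by omega
  refine mem_iUnion.2 ⟨(k - 1 - j).toNat, ?_⟩
  rw [e, add_sub_cancel_right]
  exact hj

theorem lintegral_Ioi_le_tsum {a : ℤ → ℝ} (ha : Monotone a) (hpos : ∀ k, 0 < a k)
    (hcover : ∀ x, 0 < x → ∃ k, x ∈ Ioc (a k) (a (k + 1))) (g : ℝ → ℝ≥0∞) (k : ℤ) :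
    ∫⁻ u in Ioi (a k), g u ≤ ∑' i : ℕ, ∫⁻ u in Ioc (a (k + i)) (a (k + i + 1)), g u := by
  refine (lintegral_mono_set fun x hx => ?_).trans (lintegral_iUnion_le _ _)
  obtain ⟨j, hj⟩ := hcover x ((hpos k).trans hx)
  have hjk : k < j + 1 := ha.reflect_lt (lt_of_lt_of_le hx hj.2)
  have e : k + ((j - k).toNat : ℤ) = j := by omega
  refine mem_iUnion.2 ⟨(j - k).toNat, ?_⟩
  rwa [e]

theorem add_rpow_le_two_rpow_mul (x y : ℝ≥0∞) {q : ℝ} (hq : 0 < q) :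
    (x + y) ^ q ≤ 2 ^ q * (x ^ q + y ^ q) := by
  wlog hxy : x ≤ y generalizing x y
  · rw [add_comm x, add_comm (x ^ q)]
    exact this y x (le_of_not_ge hxy)
  calc (x + y) ^ q ≤ (2 * y) ^ q := by rw [two_mul]; gcongr
    _ = 2 ^ q * y ^ q := ENNReal.mul_rpow_of_nonneg _ _ hq.le
    _ ≤ 2 ^ q * (x ^ q + y ^ q) := by gcongr; exact le_add_self

/-- A discrete Hardy inequality. -/
theorem tsum_geometric_rpow_le {μ : ℝ≥0∞} (hμ : μ < 1) {r q : ℝ} (hr : 0 < r) (hq : 0 < q) :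
    ∃ C : ℝ≥0, ∀ (e : ℕ → ℤ) (D : ℤ → ℝ≥0∞),
      ∑' k : ℤ, (∑' i : ℕ, (μ ^ i * (μ ^ i * D (k + e i))) ^ r) ^ (q / r) ≤
        C * ∑' k : ℤ, D k ^ q := by
  have hgeom : ∀ s : ℝ, 0 < s → ∑' i : ℕ, (μ ^ i) ^ s ≠ ∞ := by
    intro s hs
    have : ∀ i : ℕ, (μ ^ i) ^ s = (μ ^ s) ^ i := fun i => by
      rw [← ENNReal.rpow_natCast, ← ENNReal.rpow_mul, mul_comm, ENNReal.rpow_mul,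
        ENNReal.rpow_natCast]
    simp_rw [this]
    rw [ENNReal.tsum_geometric]
    have h1 : μ ^ s < 1 := ENNReal.rpow_lt_one hμ hs
    exact ENNReal.inv_ne_top.2 (tsub_pos_of_lt h1).ne'
  set G := ∑' i : ℕ, (μ ^ i) ^ r with hG
  set H := ∑' i : ℕ, (μ ^ i) ^ q with hH
  have hC : G ^ (q / r) * H ≠ ∞ := ENNReal.mul_ne_top
    (ENNReal.rpow_ne_top_of_nonneg (by positivity) (hgeom r hr)) (hgeom q hq)
  refine ⟨(G ^ (q / r) * H).toNNReal, fun e D => ?_⟩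
  rw [ENNReal.coe_toNNReal hC]
  -- Each `μ ^ i * D (k + e i)` is bounded by the whole `ℓ^q` sum; the first factor `μ ^ i` sums the
  -- inner series, the second sums over `i` after the order of summation is exchanged. This avoids
  -- distinguishing `q ≤ r` from `r ≤ q`.
  have hk : ∀ k : ℤ, (∑' i : ℕ, (μ ^ i * (μ ^ i * D (k + e i))) ^ r) ^ (q / r) ≤
      G ^ (q / r) * ∑' i : ℕ, (μ ^ i * D (k + e i)) ^ q := by
    intro k
    set S := ∑' i : ℕ, (μ ^ i * D (k + e i)) ^ q with hS
    have hi : ∀ i : ℕ, (μ ^ i * (μ ^ i * D (k + e i))) ^ r ≤ (μ ^ i) ^ r * S ^ (r / q) := by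
      intro i
      rw [ENNReal.mul_rpow_of_nonneg _ _ hr.le]
      gcongr
      have : (μ ^ i * D (k + e i)) ^ q ≤ S :=
        ENNReal.le_tsum (f := fun i : ℕ => (μ ^ i * D (k + e i)) ^ q) i
      calc (μ ^ i * D (k + e i)) ^ r = ((μ ^ i * D (k + e i)) ^ q) ^ (r / q) := by
            rw [← ENNReal.rpow_mul, mul_div_cancel₀ _ hq.ne']
        _ ≤ S ^ (r / q) := by gcongr
    calc (∑' i : ℕ, (μ ^ i * (μ ^ i * D (k + e i))) ^ r) ^ (q / r)
        ≤ (∑' i : ℕ, (μ ^ i) ^ r * S ^ (r / q)) ^ (q / r) := by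
          gcongr with i
          exact hi i
      _ = G ^ (q / r) * S := by
          rw [ENNReal.tsum_mul_right, ENNReal.mul_rpow_of_nonneg _ _ (by positivity),
            ← ENNReal.rpow_mul, div_mul_div_cancel₀ hq.ne', div_self hr.ne', ENNReal.rpow_one]
  calc ∑' k : ℤ, (∑' i : ℕ, (μ ^ i * (μ ^ i * D (k + e i))) ^ r) ^ (q / r)
      ≤ ∑' k : ℤ, G ^ (q / r) * ∑' i : ℕ, (μ ^ i * D (k + e i)) ^ q := ENNReal.tsum_le_tsum hk
    _ = G ^ (q / r) * ∑' i : ℕ, ∑' k : ℤ, (μ ^ i) ^ q * D (k + e i) ^ q := by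
        rw [ENNReal.tsum_mul_left, ENNReal.tsum_comm]
        simp_rw [ENNReal.mul_rpow_of_nonneg _ _ hq.le]
    _ = G ^ (q / r) * ∑' i : ℕ, (μ ^ i) ^ q * ∑' k : ℤ, D k ^ q := by
        congr 2
        funext i
        rw [ENNReal.tsum_mul_left]
        congr 1
        exact (Equiv.addRight (e i)).tsum_eq fun k => D k ^ q
    _ = G ^ (q / r) * H * ∑' k : ℤ, D k ^ q := by
        rw [ENNReal.tsum_mul_right, mul_assoc]

end Sequences

/-! ### The points where `ρ` equals `2 ^ k` -/

section Scale

variable {q₀ q₁ : ℝ} {b₀ b₁ : ℝ → ℝ}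

/-- A sequence of points at which `ρ` takes the values `2 ^ k`. -/
structure DyadicScale (q₀ q₁ : ℝ) (b₀ b₁ : ℝ → ℝ) where
  t : ℤ → ℝ
  ratio : ℝ
  one_le_ratio : 1 ≤ ratio
  pos : ∀ k, 0 < t k
  strictMono : StrictMono t
  rho_eq : ∀ k, rho q₀ q₁ b₀ b₁ (t k) = 2 ^ k
  cover : ∀ x, 0 < x → ∃ k, x ∈ Ioc (t k) (t (k + 1))
  tailNorm_le : ∀ k, 2 * tailNorm q₁ b₁ (t (k + 1)) ≤ tailNorm q₁ b₁ (t k)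
  le_ratio_mul : ∀ k, tailNorm q₁ b₁ (t k) ≤ ratio * tailNorm q₁ b₁ (t (k + 1))

theorem rho_mul_tailNorm (hq₁ : 0 < q₁) (hb₁ : SlowlyVaryingZero q₁ b₁) {t : ℝ} (ht : 0 < t) :
    rho q₀ q₁ b₀ b₁ t * tailNorm q₁ b₁ t = tailNorm q₀ b₀ t :=
  div_mul_cancel₀ _ (hb₁.tailNorm_pos hq₁ ht).ne'

theorem rho_pos (hq₀ : 0 < q₀) (hq₁ : 0 < q₁) (hb₀ : SlowlyVaryingZero q₀ b₀)
    (hb₁ : SlowlyVaryingZero q₁ b₁) {t : ℝ} (ht : 0 < t) : 0 < rho q₀ q₁ b₀ b₁ t :=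
  div_pos (hb₀.tailNorm_pos hq₀ ht) (hb₁.tailNorm_pos hq₁ ht)

/-- Since `ρ_ε = ρ ^ (1 + ε) * T_1 ^ ε`, almost monotonicity of `ρ_ε` forbids `T_1` to drop by more
than a constant factor while `ρ` merely doubles. -/
theorem exists_tailNorm_le_of_rho_eq_two_mul (hq₀ : 0 < q₀) (hq₁ : 0 < q₁)
    (hb₀ : SlowlyVaryingZero q₀ b₀) (hb₁ : SlowlyVaryingZero q₁ b₁)
    (hcond : RhoCondition q₀ q₁ b₀ b₁) : ∃ L : ℝ, ∀ s t : ℝ, 0 < s → s ≤ t →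
      rho q₀ q₁ b₀ b₁ t = 2 * rho q₀ q₁ b₀ b₁ s →
      tailNorm q₁ b₁ s ≤ L * tailNorm q₁ b₁ t := by
  obtain ⟨ε, hε, g, hg, c, C, hc, hC, h⟩ := hcond
  refine ⟨(C * c⁻¹ * 2 ^ (1 + ε)) ^ (1 / ε), fun s t hs hst hρ => ?_⟩
  have ht := hs.trans_le hst
  have hx := hb₁.tailNorm_pos hq₁ hs
  have hy := hb₁.tailNorm_pos hq₁ ht
  have hr := rho_pos hq₀ hq₁ hb₀ hb₁ hs
  have h1 : rhoEps ε q₀ q₁ b₀ b₁ s ≤ C * c⁻¹ * rhoEps ε q₀ q₁ b₀ b₁ t := by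
    calc rhoEps ε q₀ q₁ b₀ b₁ s ≤ C * g s := (h s hs).2
      _ ≤ C * g t := by gcongr; exact hg hs ht hst
      _ = C * c⁻¹ * (c * g t) := by field_simp
      _ ≤ C * c⁻¹ * rhoEps ε q₀ q₁ b₀ b₁ t :=
        mul_le_mul_of_nonneg_left (h t ht).1 (by positivity)
  have e : ∀ r x : ℝ, 0 < r → 0 < x → (r * x) ^ (1 + ε) / x = r ^ (1 + ε) * x ^ ε := by
    intro r x hr hx
    rw [Real.mul_rpow hr.le hx.le, Real.rpow_add hx, Real.rpow_one]
    field_simp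
  rw [rhoEps, rhoEps, ← rho_mul_tailNorm hq₁ hb₁ hs, ← rho_mul_tailNorm hq₁ hb₁ ht, hρ,
    e _ _ hr hx, e _ _ (by positivity) hy, Real.mul_rpow (by norm_num) hr.le] at h1
  have h2 : tailNorm q₁ b₁ s ^ ε ≤ C * c⁻¹ * 2 ^ (1 + ε) * tailNorm q₁ b₁ t ^ ε := by
    refine le_of_mul_le_mul_left (h1.trans (le_of_eq ?_)) (Real.rpow_pos_of_pos hr (1 + ε))
    ring
  refine (Real.rpow_le_rpow_iff hx.le (by positivity) hε).1 (h2.trans (le_of_eq ?_))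
  rw [Real.mul_rpow (by positivity) hy.le, ← Real.rpow_mul (by positivity),
    one_div_mul_cancel hε.ne', Real.rpow_one]

theorem exists_rho_eq (hq₀ : 0 < q₀) (hq₁ : 0 < q₁)
    (hb₀ : SlowlyVaryingZero q₀ b₀) (hb₁ : SlowlyVaryingZero q₁ b₁)
    (hzero : Tendsto (rho q₀ q₁ b₀ b₁) (𝓝[>] 0) (𝓝 0))
    (htop : Tendsto (rho q₀ q₁ b₀ b₁) atTop atTop) {y : ℝ} (hy : 0 < y) :
    ∃ t, 0 < t ∧ rho q₀ q₁ b₀ b₁ t = y := by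
  have hcont : ContinuousOn (rho q₀ q₁ b₀ b₁) (Ioi 0) :=
    (hb₀.continuousOn_tailNorm hq₀).div (hb₁.continuousOn_tailNorm hq₁)
      fun t ht => (hb₁.tailNorm_pos hq₁ ht).ne'
  obtain ⟨a, ha, ha0⟩ := ((hzero.eventually (gt_mem_nhds hy)).and self_mem_nhdsWithin).exists
  obtain ⟨c, hc, hc0⟩ := ((htop.eventually_gt_atTop y).and (eventually_gt_atTop (0 : ℝ))).exists
  obtain ⟨t, ht, hty⟩ := isPreconnected_Ioi.intermediate_value ha0 hc0 hcont ⟨ha.le, hc.le⟩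
  exact ⟨t, ht, hty⟩

theorem nonempty_dyadicScale (hq₀ : 0 < q₀) (hq₁ : 0 < q₁)
    (hb₀ : SlowlyVaryingZero q₀ b₀) (hb₁ : SlowlyVaryingZero q₁ b₁)
    (hcond : RhoCondition q₀ q₁ b₀ b₁) (hmono : MonotoneOn (rho q₀ q₁ b₀ b₁) (Ioi 0))
    (hzero : Tendsto (rho q₀ q₁ b₀ b₁) (𝓝[>] 0) (𝓝 0))
    (htop : Tendsto (rho q₀ q₁ b₀ b₁) atTop atTop) : Nonempty (DyadicScale q₀ q₁ b₀ b₁) := by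
  choose t ht hρ using fun k : ℤ => exists_rho_eq hq₀ hq₁ hb₀ hb₁ hzero htop
    (zpow_pos (zero_lt_two' ℝ) k)
  obtain ⟨L, hL⟩ := exists_tailNorm_le_of_rho_eq_two_mul hq₀ hq₁ hb₀ hb₁ hcond
  have hlt : ∀ {x y : ℝ}, 0 < x → 0 < y → rho q₀ q₁ b₀ b₁ x < rho q₀ q₁ b₀ b₁ y → x < y :=
    fun hx hy h => not_le.1 fun hle => (hmono hy hx hle).not_gt h
  have hpow : ∀ k : ℤ, (2 : ℝ) ^ (k + 1) = 2 * 2 ^ k := fun k => by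
    rw [zpow_add_one₀ (two_ne_zero' ℝ), mul_comm]
  have hstep : ∀ k, t k < t (k + 1) := fun k => by
    refine hlt (ht k) (ht (k + 1)) ?_
    rw [hρ, hρ, hpow]
    linarith [zpow_pos (zero_lt_two' ℝ) k]
  have hsm : StrictMono t := strictMono_int_of_lt_succ hstep
  refine ⟨⟨t, max 1 L, le_max_left _ _, ht, hsm, hρ, fun x hx => ?_, fun k => ?_, fun k => ?_⟩⟩
  · obtain ⟨k, hk1, hk2⟩ := exists_mem_Ioc_zpow (rho_pos hq₀ hq₁ hb₀ hb₁ hx) one_lt_two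
    have h1 : t k < x := hlt (ht k) hx (by rwa [hρ])
    -- As `ρ` need not be strictly increasing, `x` may lie beyond `t (k + 1)` while `ρ(x) = 2 ^ (k +
    -- 1)`; it then belongs to the next block.
    have h2 : x < t (k + 1 + 1) := hlt hx (ht _) (by
      rw [hρ, hpow (k + 1)]
      linarith [zpow_pos (zero_lt_two' ℝ) (k + 1)])
    rcases le_or_gt x (t (k + 1)) with h | h
    · exact ⟨k, h1, h⟩
    · exact ⟨k + 1, h, h2.le⟩
  -- The product `T_0 = ρ T_1` does not increase while `ρ` doubles, so `T_1` at least halves.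
  · have h0 := hb₀.tailNorm_antitone hq₀ (ht k) (hstep k).le
    rw [← rho_mul_tailNorm hq₁ hb₁ (ht k), ← rho_mul_tailNorm hq₁ hb₁ (ht (k + 1)), hρ, hρ,
      hpow, mul_comm 2, mul_assoc] at h0
    exact le_of_mul_le_mul_left h0 (zpow_pos (zero_lt_two' ℝ) k)
  · refine (hL (t k) (t (k + 1)) (ht k) (hstep k).le (by rw [hρ, hρ, hpow])).trans ?_
    exact mul_le_mul_of_nonneg_right (le_max_right _ _) (tailNorm_nonneg _)

theorem DyadicScale.tailNorm_zero_eq (S : DyadicScale q₀ q₁ b₀ b₁) (hq₁ : 0 < q₁)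
    (hb₁ : SlowlyVaryingZero q₁ b₁) (k : ℤ) :
    tailNorm q₀ b₀ (S.t k) = 2 ^ k * tailNorm q₁ b₁ (S.t k) := by
  rw [← rho_mul_tailNorm hq₁ hb₁ (S.pos k), S.rho_eq]

theorem DyadicScale.tailNorm_zero_le (S : DyadicScale q₀ q₁ b₀ b₁) (hq₁ : 0 < q₁)
    (hb₁ : SlowlyVaryingZero q₁ b₁) (k : ℤ) :
    tailNorm q₀ b₀ (S.t k) ≤ S.ratio * tailNorm q₀ b₀ (S.t (k + 1)) := by
  have h2 := zpow_pos (zero_lt_two' ℝ) k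
  have h1 := tailNorm_nonneg (q := q₁) (b := b₁) (S.t (k + 1))
  have h3 := S.one_le_ratio
  rw [S.tailNorm_zero_eq hq₁ hb₁, S.tailNorm_zero_eq hq₁ hb₁, zpow_add_one₀ (two_ne_zero' ℝ)]
  calc 2 ^ k * tailNorm q₁ b₁ (S.t k) ≤ 2 ^ k * (S.ratio * tailNorm q₁ b₁ (S.t (k + 1))) := by
        gcongr
        exact S.le_ratio_mul k
    _ ≤ S.ratio * (2 ^ k * 2 * tailNorm q₁ b₁ (S.t (k + 1))) := by
        have : 0 ≤ 2 ^ k * (S.ratio * tailNorm q₁ b₁ (S.t (k + 1))) := by positivity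
        linarith

end Scale

/-- The hypothesis says that `X` loses a geometric factor along the shifts `e i`. Moving `X k` into
the inner sum reduces the claim to `tsum_geometric_rpow_le` for `D = X * Y`. -/
theorem tsum_weighted_hardy {μ : ℝ≥0∞} (hμ : μ < 1) {r q : ℝ} (hr : 0 < r) (hq : 0 < q)
    (c c₀ : ℝ≥0) : ∃ C : ℝ≥0, ∀ (e : ℕ → ℤ) (X Y : ℤ → ℝ≥0∞),
      (∀ k i, X k ≤ c * (μ ^ i * (μ ^ i * X (k + e i)))) →
      ∑' k : ℤ, (X k * (c₀ * ∑' i : ℕ, Y (k + e i) ^ r) ^ (1 / r)) ^ q ≤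
        C * ∑' k : ℤ, (X k * Y k) ^ q := by
  obtain ⟨C, hC⟩ := tsum_geometric_rpow_le hμ hr hq
  have hfin : ((c₀ : ℝ≥0∞) * c ^ r) ^ (q / r) ≠ ∞ :=
    ENNReal.rpow_ne_top_of_nonneg (by positivity)
      (ENNReal.mul_ne_top ENNReal.coe_ne_top (ENNReal.rpow_ne_top_of_nonneg hr.le
        ENNReal.coe_ne_top))
  refine ⟨(((c₀ : ℝ≥0∞) * c ^ r) ^ (q / r)).toNNReal * C, fun e X Y hX => ?_⟩
  rw [ENNReal.coe_mul, ENNReal.coe_toNNReal hfin, mul_assoc]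
  have hk : ∀ k, (X k * (c₀ * ∑' i : ℕ, Y (k + e i) ^ r) ^ (1 / r)) ^ q ≤
      ((c₀ : ℝ≥0∞) * c ^ r) ^ (q / r) *
        (∑' i : ℕ, (μ ^ i * (μ ^ i * (X (k + e i) * Y (k + e i)))) ^ r) ^ (q / r) := by
    intro k
    have e1 : (X k * (c₀ * ∑' i : ℕ, Y (k + e i) ^ r) ^ (1 / r)) ^ q =
        (c₀ * ∑' i : ℕ, (X k * Y (k + e i)) ^ r) ^ (q / r) := by
      have : ∀ i : ℕ, (X k * Y (k + e i)) ^ r = X k ^ r * Y (k + e i) ^ r := fun i =>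
        ENNReal.mul_rpow_of_nonneg _ _ hr.le
      simp_rw [this]
      rw [ENNReal.tsum_mul_left, mul_left_comm, ENNReal.mul_rpow_of_nonneg (X k ^ r) _
        (by positivity), ENNReal.mul_rpow_of_nonneg _ _ hq.le, ← ENNReal.rpow_mul,
        ← ENNReal.rpow_mul, mul_div_cancel₀ _ hr.ne', one_div_mul_eq_div]
    rw [e1, ← ENNReal.mul_rpow_of_nonneg _ _ (by positivity), mul_assoc,
      ← ENNReal.tsum_mul_left (a := (c : ℝ≥0∞) ^ r)]
    refine ENNReal.rpow_le_rpow (mul_le_mul_right (ENNReal.tsum_le_tsum fun i => ?_) _)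
      (by positivity)
    rw [← ENNReal.mul_rpow_of_nonneg _ _ hr.le]
    refine ENNReal.rpow_le_rpow ?_ hr.le
    calc X k * Y (k + e i) ≤ c * (μ ^ i * (μ ^ i * X (k + e i))) * Y (k + e i) := by
          gcongr
          exact hX k i
      _ = _ := by ring
  refine (ENNReal.tsum_le_tsum hk).trans ?_
  rw [ENNReal.tsum_mul_left]
  gcongr
  exact hC e fun k => X k * Y k

/-! ### Geometric growth and decay of the dyadic weights -/

section DyadicWeights

variable {b : ℝ → ℝ}

/-- Half of the exponent `α` absorbs the variation of `b`; the other half gives `2 ^ (-(i * α /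
2))`, written as two factors `μ ^ i` with `μ = 2 ^ (-(α / 4))` to fit the Hardy inequality. -/
theorem SlowlyVarying.exists_dyadic_growth (hb : SlowlyVarying b) {α : ℝ} (hα : 0 < α) :
    ∃ (c : ℝ≥0) (μ : ℝ≥0∞), μ < 1 ∧ ∀ (k : ℤ) (i : ℕ),
      ENNReal.ofReal (((2 : ℝ) ^ k) ^ α * b (2 ^ k)) ≤
        c * (μ ^ i * (μ ^ i * ENNReal.ofReal (((2 : ℝ) ^ (k + i)) ^ α * b (2 ^ (k + i))))) := by
  obtain ⟨C, hC, h⟩ := hb.exists_rpow_mul_le (half_pos hα)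
  refine ⟨C.toNNReal, ENNReal.ofReal (2 ^ (-(α / 4))), ?_, fun k i => ?_⟩
  · rw [ENNReal.ofReal_lt_one]
    exact Real.rpow_lt_one_of_one_lt_of_neg one_lt_two (by linarith)
  have hk := zpow_pos (zero_lt_two' ℝ) k
  have hki := zpow_pos (zero_lt_two' ℝ) (k + i)
  have hbk := hb.pos _ hki
  have hle : (2 : ℝ) ^ k ≤ 2 ^ (k + i) := zpow_le_zpow_right₀ one_le_two (by omega)
  change _ ≤ ENNReal.ofReal C * _
  rw [← ENNReal.ofReal_pow (by positivity), ← ENNReal.ofReal_mul (by positivity),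
    ← ENNReal.ofReal_mul (by positivity), ← ENNReal.ofReal_mul (by positivity)]
  refine ENNReal.ofReal_le_ofReal ?_
  have e1 : ∀ x : ℝ, 0 < x → x ^ α = x ^ (α / 2) * x ^ (α / 2) := fun x hx => by
    rw [← Real.rpow_add hx, add_halves]
  have e2 : ((2 : ℝ) ^ k) ^ (α / 2) =
      (2 ^ (-(α / 4))) ^ i * (2 ^ (-(α / 4))) ^ i * ((2 : ℝ) ^ (k + i)) ^ (α / 2) := by
    rw [← Real.rpow_natCast, ← Real.rpow_mul (by norm_num), ← Real.rpow_intCast,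
      ← Real.rpow_intCast, ← Real.rpow_mul (by norm_num), ← Real.rpow_mul (by norm_num),
      ← Real.rpow_add (by norm_num), ← Real.rpow_add (by norm_num)]
    congr 1
    push_cast
    ring
  calc ((2 : ℝ) ^ k) ^ α * b (2 ^ k)
      = ((2 : ℝ) ^ k) ^ (α / 2) * (((2 : ℝ) ^ k) ^ (α / 2) * b (2 ^ k)) := by
        rw [e1 _ hk, mul_assoc]
    _ ≤ ((2 : ℝ) ^ k) ^ (α / 2) * (C * (((2 : ℝ) ^ (k + i)) ^ (α / 2) * b (2 ^ (k + i)))) := by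
        exact mul_le_mul_of_nonneg_left (h _ _ hk hle) (by positivity)
    _ = _ := by
        rw [e2, e1 _ hki]
        ring

theorem SlowlyVarying.exists_dyadic_decay (hb : SlowlyVarying b) {α : ℝ} (hα : 0 < α) :
    ∃ (c : ℝ≥0) (μ : ℝ≥0∞), μ < 1 ∧ ∀ (k : ℤ) (i : ℕ),
      ENNReal.ofReal (((2 : ℝ) ^ k) ^ (-α) * b (2 ^ k)) ≤
        c * (μ ^ i * (μ ^ i * ENNReal.ofReal (((2 : ℝ) ^ (k + -(i : ℤ))) ^ (-α) *
          b (2 ^ (k + -(i : ℤ)))))) := by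
  obtain ⟨C, hC, h⟩ := hb.exists_rpow_neg_mul_le (half_pos hα)
  refine ⟨C.toNNReal, ENNReal.ofReal (2 ^ (-(α / 4))), ?_, fun k i => ?_⟩
  · rw [ENNReal.ofReal_lt_one]
    exact Real.rpow_lt_one_of_one_lt_of_neg one_lt_two (by linarith)
  have hk := zpow_pos (zero_lt_two' ℝ) k
  have hki := zpow_pos (zero_lt_two' ℝ) (k + -(i : ℤ))
  have hbk := hb.pos _ hki
  have hle : (2 : ℝ) ^ (k + -(i : ℤ)) ≤ 2 ^ k := zpow_le_zpow_right₀ one_le_two (by omega)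
  change _ ≤ ENNReal.ofReal C * _
  rw [← ENNReal.ofReal_pow (by positivity), ← ENNReal.ofReal_mul (by positivity),
    ← ENNReal.ofReal_mul (by positivity), ← ENNReal.ofReal_mul (by positivity)]
  refine ENNReal.ofReal_le_ofReal ?_
  have e1 : ∀ x : ℝ, 0 < x → x ^ (-α) = x ^ (-(α / 2)) * x ^ (-(α / 2)) := fun x hx => by
    rw [← Real.rpow_add hx]
    congr 1
    ring
  have e2 : ((2 : ℝ) ^ k) ^ (-(α / 2)) =
      (2 ^ (-(α / 4))) ^ i * (2 ^ (-(α / 4))) ^ i *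
        ((2 : ℝ) ^ (k + -(i : ℤ))) ^ (-(α / 2)) := by
    rw [← Real.rpow_natCast, ← Real.rpow_mul (by norm_num), ← Real.rpow_intCast,
      ← Real.rpow_intCast, ← Real.rpow_mul (by norm_num), ← Real.rpow_mul (by norm_num),
      ← Real.rpow_add (by norm_num), ← Real.rpow_add (by norm_num)]
    congr 1
    push_cast
    ring
  calc ((2 : ℝ) ^ k) ^ (-α) * b (2 ^ k)
      = ((2 : ℝ) ^ k) ^ (-(α / 2)) * (((2 : ℝ) ^ k) ^ (-(α / 2)) * b (2 ^ k)) := by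
        rw [e1 _ hk, mul_assoc]
    _ ≤ ((2 : ℝ) ^ k) ^ (-(α / 2)) * (C * (((2 : ℝ) ^ (k + -(i : ℤ))) ^ (-(α / 2)) *
          b (2 ^ (k + -(i : ℤ))))) := by
        exact mul_le_mul_of_nonneg_left (h _ _ hki hle) (by positivity)
    _ = _ := by
        rw [e2, e1 _ hki]
        ring

end DyadicWeights

/-! ### Two-sided estimates of the `K`-functional -/

section BesovEstimates

variable {n : ℕ} {𝕜 : Type*} [RCLike 𝕜] (E : RIFunctionNorm n) {q : ℝ} {b : ℝ → ℝ}

theorem besovNorm_rpow (hq : 0 < q) (hb : ∀ u, 0 < u → 0 ≤ b u)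
    (f : EuclideanSpace ℝ (Fin n) →ₘ[volume] 𝕜) :
    besovNorm E q b f ^ q = ∫⁻ u in Ioi 0, logWeight q b u * modulus E f u ^ q := by
  rw [besovNorm, eLpNorm'_eq_lintegral_enorm, ← ENNReal.rpow_mul, one_div_mul_cancel hq.ne',
    ENNReal.rpow_one]
  refine setLIntegral_congr_fun measurableSet_Ioi fun u hu => ?_
  rw [enorm_eq_self]
  exact ofReal_weight_mul_rpow hq hu (hb u hu) _

theorem SlowlyVarying.aemeasurable_logWeight_restrict (hb : SlowlyVarying b) {s : Set ℝ}
    (hs : s ⊆ Ioi 0) : AEMeasurable (logWeight q b) (volume.restrict s) :=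
  hb.logWeight_aemeasurable.mono_measure (Measure.restrict_mono hs le_rfl)

theorem SlowlyVaryingZero.lintegral_Ioi_mul_const (hq : 0 < q) (hb : SlowlyVaryingZero q b)
    {t : ℝ} (ht : 0 < t) (y : ℝ≥0∞) :
    ∫⁻ u in Ioi t, logWeight q b u * y ^ q = (ENNReal.ofReal (tailNorm q b t) * y) ^ q := by
  rw [lintegral_mul_const'' _ (hb.aemeasurable_logWeight_restrict (Ioi_subset_Ioi ht.le)),
    hb.lintegral_Ioi_eq hq ht, ENNReal.mul_rpow_of_nonneg _ _ hq.le,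
    ENNReal.ofReal_rpow_of_nonneg (tailNorm_nonneg _) hq.le]

theorem SlowlyVaryingZero.lintegral_Ioc_mul_le (hq : 0 < q) (hb : SlowlyVaryingZero q b)
    {ω : ℝ → ℝ≥0∞} (hω : Monotone ω) {s t : ℝ} (hs : 0 < s) :
    ∫⁻ u in Ioc s t, logWeight q b u * ω u ^ q ≤
      (ENNReal.ofReal (tailNorm q b s) * ω t) ^ q := by
  rw [← hb.lintegral_Ioi_mul_const hq hs]
  refine (setLIntegral_mono' measurableSet_Ioc fun u hu => ?_).trans
    (lintegral_mono_set (Ioc_subset_Ioi_self : Ioc s t ⊆ Ioi s))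
  gcongr
  exact hω hu.2

/-- The modulus is non-decreasing, so the part of the integral over `(t, ∞)` already suffices. -/
theorem tailNorm_mul_modulus_le_besovNorm (hq : 0 < q) (hb : SlowlyVaryingZero q b)
    (f : EuclideanSpace ℝ (Fin n) →ₘ[volume] 𝕜) {t : ℝ} (ht : 0 < t) :
    ENNReal.ofReal (tailNorm q b t) * modulus E f t ≤ besovNorm E q b f := by
  rw [← ENNReal.rpow_le_rpow_iff hq, ← hb.lintegral_Ioi_mul_const hq ht,
    besovNorm_rpow E hq fun u hu => (hb.pos u hu).le]
  refine (setLIntegral_mono' measurableSet_Ioi fun u hu => ?_).trans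
    (lintegral_mono_set (Ioi_subset_Ioi ht.le))
  gcongr
  exact modulus_mono E f (le_of_lt hu)

variable {q₀ q₁ : ℝ} {b₀ b₁ : ℝ → ℝ}

/-- The lower half of the Holmstedt-type formula: the identity `T_0 = ρ T_1` gives both parts of a
splitting the same weight. -/
theorem tailNorm_mul_modulus_le_kFunctional (hq₀ : 0 < q₀) (hq₁ : 0 < q₁)
    (hb₀ : SlowlyVaryingZero q₀ b₀) (hb₁ : SlowlyVaryingZero q₁ b₁)
    (f : EuclideanSpace ℝ (Fin n) →ₘ[volume] 𝕜) {t : ℝ} (ht : 0 < t) :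
    ENNReal.ofReal (tailNorm q₀ b₀ t) * modulus E f t ≤
      kFunctional (besovSpace E 𝕜 q₀ b₀) (besovSpace E 𝕜 q₁ b₁) (besovNorm E q₀ b₀)
        (besovNorm E q₁ b₁) (rho q₀ q₁ b₀ b₁ t) f := by
  refine le_iInf₂ fun f₀ _ => le_iInf₂ fun f₁ _ => le_iInf fun hf => ?_
  rw [hf]
  refine (mul_le_mul_right (modulus_add_le E f₀ f₁ t) _).trans ?_
  rw [mul_add]
  refine add_le_add (tailNorm_mul_modulus_le_besovNorm E hq₀ hb₀ f₀ ht) ?_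
  rw [← rho_mul_tailNorm hq₁ hb₁ ht, ENNReal.ofReal_mul (rho_pos hq₀ hq₁ hb₀ hb₁ ht).le,
    mul_assoc]
  gcongr
  exact tailNorm_mul_modulus_le_besovNorm E hq₁ hb₁ f₁ ht

theorem kFunctional_mono {V : Type*} [AddCommGroup V] (A₀ A₁ : Set V) (N₀ N₁ : V → ℝ≥0∞) (f : V) :
    Monotone fun t => kFunctional A₀ A₁ N₀ N₁ t f := by
  intro s t hst
  refine iInf₂_mono fun f₀ _ => iInf₂_mono fun f₁ _ => iInf_mono fun _ => ?_
  gcongr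

theorem kFunctional_le {V : Type*} [AddCommGroup V] {A₀ A₁ : Set V} {N₀ N₁ : V → ℝ≥0∞}
    {f f₀ f₁ : V} (h₀ : f₀ ∈ A₀) (h₁ : f₁ ∈ A₁) (hf : f = f₀ + f₁) (t : ℝ) :
    kFunctional A₀ A₁ N₀ N₁ t f ≤ N₀ f₀ + ENNReal.ofReal t * N₁ f₁ :=
  iInf₂_le_of_le f₀ h₀ (iInf₂_le_of_le f₁ h₁ (iInf_le_of_le hf le_rfl))

theorem le_rpow_one_div {x y : ℝ≥0∞} (hq : 0 < q) (h : x ^ q ≤ y) : x ≤ y ^ (1 / q) :=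
  (ENNReal.le_rpow_inv_iff hq).2 h |>.trans_eq (by rw [one_div])

/-- The upper half of a Holmstedt-type formula, in discrete form. -/
theorem exists_kFunctional_le (n : ℕ) (hq₀ : 0 < q₀) (hq₁ : 0 < q₁)
    (hb₀ : SlowlyVaryingZero q₀ b₀) (hb₁ : SlowlyVaryingZero q₁ b₁)
    (S : DyadicScale q₀ q₁ b₀ b₁) : ∃ C₀ C₁ : ℝ≥0, ∀ (E : RIFunctionNorm n) (𝕜 : Type*)
    [RCLike 𝕜], ∀ f ∈ E.space 𝕜, ∀ k : ℤ,
      kFunctional (besovSpace E 𝕜 q₀ b₀) (besovSpace E 𝕜 q₁ b₁) (besovNorm E q₀ b₀)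
        (besovNorm E q₁ b₁) (2 ^ k) f ≤
      (C₀ * ∑' i : ℕ, (ENNReal.ofReal (tailNorm q₀ b₀ (S.t (k + -(i : ℤ)))) *
        modulus E f (S.t (k + -(i : ℤ)))) ^ q₀) ^ (1 / q₀) +
      ENNReal.ofReal (2 ^ k) * (C₁ * ∑' i : ℕ, (ENNReal.ofReal (tailNorm q₁ b₁ (S.t (k + i))) *
        modulus E f (S.t (k + i))) ^ q₁) ^ (1 / q₁) := by
  obtain ⟨C, hC⟩ := exists_decomposition n
  obtain ⟨C', hC'⟩ := hb₁.exists_lintegral_Ioc_zero_le hq₁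
  have hL : 0 ≤ S.ratio := zero_le_one.trans S.one_le_ratio
  -- In `c₀`, the factor 2 comes from the bounds on the modulus of `f₀`, `S.ratio` from passing
  -- between tails at the two ends of a block, and 1 from `(t_k, ∞)`. In `c₁`, the first term is the
  -- Hardy estimate on `(0, t_k]` and the second the blocks beyond `t_k`.
  let c₀ : ℝ≥0∞ := 2 ^ q₀ * (ENNReal.ofReal S.ratio ^ q₀ + 1)
  let c₁ : ℝ≥0∞ := C' * C ^ q₁ + ENNReal.ofReal S.ratio ^ q₁
  have hc₀ : c₀ ≠ ∞ := ENNReal.mul_ne_top (ENNReal.rpow_ne_top_of_nonneg hq₀.le (by simp))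
    (ENNReal.add_ne_top.2 ⟨ENNReal.rpow_ne_top_of_nonneg hq₀.le (by simp), by simp⟩)
  have hc₁ : c₁ ≠ ∞ := ENNReal.add_ne_top.2 ⟨ENNReal.mul_ne_top (by simp)
    (ENNReal.rpow_ne_top_of_nonneg hq₁.le (by simp)),
    ENNReal.rpow_ne_top_of_nonneg hq₁.le (by simp)⟩
  refine ⟨c₀.toNNReal, c₁.toNNReal, fun E 𝕜 _ f hf k => ?_⟩
  rw [ENNReal.coe_toNNReal hc₀, ENNReal.coe_toNNReal hc₁]
  have ht := S.pos k
  obtain ⟨f₀, hf₀, f₁, hf₁, hff, h1, h2, h3, h4⟩ := hC E 𝕜 f hf (S.t k) ht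
  have hω := modulus_mono E f
  set A : ℤ → ℝ≥0∞ := fun j => ENNReal.ofReal (tailNorm q₀ b₀ (S.t j)) * modulus E f (S.t j)
    with hA
  set B : ℤ → ℝ≥0∞ := fun j => ENNReal.ofReal (tailNorm q₁ b₁ (S.t j)) * modulus E f (S.t j)
    with hB
  have hsplit : Ioi (0 : ℝ) = Ioc 0 (S.t k) ∪ Ioi (S.t k) := (Ioc_union_Ioi_eq_Ioi ht.le).symm
  have hN₀ : besovNorm E q₀ b₀ f₀ ^ q₀ ≤ c₀ * ∑' i : ℕ, A (k + -(i : ℤ)) ^ q₀ := by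
    rw [besovNorm_rpow E hq₀ fun u hu => (hb₀.pos u hu).le, hsplit]
    refine (lintegral_union_le _ _ _).trans ?_
    have i1 : ∫⁻ u in Ioc 0 (S.t k), logWeight q₀ b₀ u * modulus E f₀ u ^ q₀ ≤
        2 ^ q₀ * (ENNReal.ofReal S.ratio ^ q₀ * ∑' i : ℕ, A (k + -(i : ℤ)) ^ q₀) := by
      calc ∫⁻ u in Ioc 0 (S.t k), logWeight q₀ b₀ u * modulus E f₀ u ^ q₀
          ≤ ∫⁻ u in Ioc 0 (S.t k), 2 ^ q₀ * (logWeight q₀ b₀ u * modulus E f u ^ q₀) := by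
            refine lintegral_mono fun u => ?_
            calc logWeight q₀ b₀ u * modulus E f₀ u ^ q₀
                ≤ logWeight q₀ b₀ u * (2 * modulus E f u) ^ q₀ := by
                  gcongr
                  exact h1 u
              _ = _ := by
                  rw [ENNReal.mul_rpow_of_nonneg _ _ hq₀.le]
                  ring
        _ = 2 ^ q₀ * ∫⁻ u in Ioc 0 (S.t k), logWeight q₀ b₀ u * modulus E f u ^ q₀ :=
            lintegral_const_mul' _ _ (ENNReal.rpow_ne_top_of_nonneg hq₀.le (by simp))
        _ ≤ _ := by
            rw [← ENNReal.tsum_mul_left]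
            gcongr
            refine (lintegral_Ioc_zero_le_tsum S.strictMono.monotone S.cover _ k).trans
              (ENNReal.tsum_le_tsum fun i => ?_)
            refine (hb₀.lintegral_Ioc_mul_le hq₀ hω (S.pos _)).trans ?_
            rw [← ENNReal.mul_rpow_of_nonneg _ _ hq₀.le]
            refine ENNReal.rpow_le_rpow ?_ hq₀.le
            simp only [hA]
            rw [← sub_eq_add_neg, ← mul_assoc, ← ENNReal.ofReal_mul hL]
            gcongr
            have := S.tailNorm_zero_le hq₁ hb₁ (k - i - 1)
            rwa [sub_add_cancel] at this
    have i2 : ∫⁻ u in Ioi (S.t k), logWeight q₀ b₀ u * modulus E f₀ u ^ q₀ ≤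
        2 ^ q₀ * ∑' i : ℕ, A (k + -(i : ℤ)) ^ q₀ := by
      calc ∫⁻ u in Ioi (S.t k), logWeight q₀ b₀ u * modulus E f₀ u ^ q₀
          ≤ ∫⁻ u in Ioi (S.t k), logWeight q₀ b₀ u * (2 * modulus E f (S.t k)) ^ q₀ := by
            refine lintegral_mono fun u => ?_
            dsimp only
            gcongr
            exact h2 u
        _ = 2 ^ q₀ * A k ^ q₀ := by
            rw [hb₀.lintegral_Ioi_mul_const hq₀ ht, mul_left_comm,
              ENNReal.mul_rpow_of_nonneg _ _ hq₀.le]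
        _ ≤ _ := by
            gcongr
            simpa using ENNReal.le_tsum (f := fun i : ℕ => A (k + -(i : ℤ)) ^ q₀) 0
    refine (add_le_add i1 i2).trans (le_of_eq ?_)
    simp only [c₀]
    ring
  have hN₁ : besovNorm E q₁ b₁ f₁ ^ q₁ ≤ c₁ * ∑' i : ℕ, B (k + i) ^ q₁ := by
    rw [besovNorm_rpow E hq₁ fun u hu => (hb₁.pos u hu).le, hsplit]
    refine (lintegral_union_le _ _ _).trans ?_
    have i1 : ∫⁻ u in Ioc 0 (S.t k), logWeight q₁ b₁ u * modulus E f₁ u ^ q₁ ≤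
        C' * C ^ q₁ * ∑' i : ℕ, B (k + i) ^ q₁ := by
      calc ∫⁻ u in Ioc 0 (S.t k), logWeight q₁ b₁ u * modulus E f₁ u ^ q₁
          ≤ ∫⁻ u in Ioc 0 (S.t k), (logWeight q₁ b₁ u * ENNReal.ofReal (u / S.t k) ^ q₁) *
              ((C : ℝ≥0∞) * modulus E f (S.t k)) ^ q₁ := by
            refine setLIntegral_mono' measurableSet_Ioc fun u hu => ?_
            calc logWeight q₁ b₁ u * modulus E f₁ u ^ q₁
                ≤ logWeight q₁ b₁ u *
                  (C * ENNReal.ofReal (u / S.t k) * modulus E f (S.t k)) ^ q₁ := by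
                  gcongr
                  exact h4 u hu.1 hu.2
              _ = _ := by
                  simp only [ENNReal.mul_rpow_of_nonneg _ _ hq₁.le]
                  ring
        _ = (∫⁻ u in Ioc 0 (S.t k), logWeight q₁ b₁ u * ENNReal.ofReal (u / S.t k) ^ q₁) *
              ((C : ℝ≥0∞) * modulus E f (S.t k)) ^ q₁ := by
            refine lintegral_mul_const'' _ ?_
            refine (hb₁.aemeasurable_logWeight_restrict Ioc_subset_Ioi_self).mul ?_
            fun_prop
        _ ≤ (C' * ENNReal.ofReal (tailNorm q₁ b₁ (S.t k) ^ q₁)) *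
              ((C : ℝ≥0∞) * modulus E f (S.t k)) ^ q₁ := by
            gcongr
            exact hC' _ ht
        _ = C' * C ^ q₁ * B k ^ q₁ := by
            rw [← ENNReal.ofReal_rpow_of_nonneg (tailNorm_nonneg _) hq₁.le,
              ENNReal.mul_rpow_of_nonneg _ _ hq₁.le, ENNReal.mul_rpow_of_nonneg _ _ hq₁.le]
            ring
        _ ≤ _ := by
            gcongr
            simpa using ENNReal.le_tsum (f := fun i : ℕ => B (k + i) ^ q₁) 0
    have i2 : ∫⁻ u in Ioi (S.t k), logWeight q₁ b₁ u * modulus E f₁ u ^ q₁ ≤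
        ENNReal.ofReal S.ratio ^ q₁ * ∑' i : ℕ, B (k + i) ^ q₁ := by
      calc ∫⁻ u in Ioi (S.t k), logWeight q₁ b₁ u * modulus E f₁ u ^ q₁
          ≤ ∫⁻ u in Ioi (S.t k), logWeight q₁ b₁ u * modulus E f u ^ q₁ := by
            refine lintegral_mono fun u => ?_
            dsimp only
            gcongr
            exact h3 u
        -- The modulus is taken at the right end of each block, so the indices start at `k + 1`; the
        -- missing term is restored at the end.
        _ ≤ ∑' i : ℕ, (ENNReal.ofReal S.ratio * B (k + (i + 1 : ℕ))) ^ q₁ := by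
            refine (lintegral_Ioi_le_tsum S.strictMono.monotone S.pos S.cover _ k).trans
              (ENNReal.tsum_le_tsum fun i => ?_)
            refine (hb₁.lintegral_Ioc_mul_le hq₁ hω (S.pos _)).trans ?_
            refine ENNReal.rpow_le_rpow ?_ hq₁.le
            simp only [hB]
            rw [← mul_assoc, ← ENNReal.ofReal_mul hL, Nat.cast_add_one, ← add_assoc]
            gcongr
            exact S.le_ratio_mul _
        _ = ENNReal.ofReal S.ratio ^ q₁ * ∑' i : ℕ, B (k + (i + 1 : ℕ)) ^ q₁ := by
            simp_rw [ENNReal.mul_rpow_of_nonneg _ _ hq₁.le]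
            rw [ENNReal.tsum_mul_left]
        _ ≤ _ := by
            exact mul_le_mul_right (ENNReal.tsum_comp_le_tsum_of_injective
              (add_left_injective 1) fun i : ℕ => B (k + i) ^ q₁) _
    refine (add_le_add i1 i2).trans (le_of_eq ?_)
    simp only [c₁]
    ring
  have hM₀ := le_rpow_one_div hq₀ hN₀
  have hM₁ := le_rpow_one_div hq₁ hN₁
  -- If either sum is infinite the claim is trivial; otherwise `f₀` and `f₁` lie in the Besov spaces
  -- and are admissible in the infimum.
  rcases eq_or_ne ((c₀ * ∑' i : ℕ, A (k + -(i : ℤ)) ^ q₀) ^ (1 / q₀)) ∞ with h | h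
  · rw [h, top_add]
    exact le_top
  rcases eq_or_ne ((c₁ * ∑' i : ℕ, B (k + i) ^ q₁) ^ (1 / q₁)) ∞ with h' | h'
  · rw [h', ENNReal.mul_top (by simpa using zpow_pos (zero_lt_two' ℝ) k), add_top]
    exact le_top
  have hmem₀ : f₀ ∈ besovSpace E 𝕜 q₀ b₀ := ⟨hf₀, hM₀.trans_lt h.lt_top⟩
  have hmem₁ : f₁ ∈ besovSpace E 𝕜 q₁ b₁ := ⟨hf₁, hM₁.trans_lt h'.lt_top⟩
  refine (kFunctional_le hmem₀ hmem₁ hff _).trans ?_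
  gcongr

end BesovEstimates

/-! ### Both norms on a single block -/

section Blocks

variable {q θ : ℝ} {b : ℝ → ℝ}

theorem rpow_one_sub_mul {s : ℝ} (hs : 0 < s) (x : ℝ) :
    s ^ (1 - θ) * x = s * (s ^ (-θ) * x) := by
  rw [sub_eq_add_neg, Real.rpow_add hs, Real.rpow_one, mul_assoc]

/-- The function `s ^ (1 - θ) * b s` is almost increasing, and `s` varies by a factor of at most 2
on the block, so the weight is controlled by its value at the right end. -/
theorem SlowlyVarying.exists_lintegral_dyadic_le (hq : 0 < q) (hb : SlowlyVarying b)
    (hθ : θ < 1) : ∃ C : ℝ≥0, ∀ K : ℝ → ℝ≥0∞, Monotone K → ∀ x : ℝ, 0 < x →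
      ∫⁻ s in Ioc x (2 * x), logWeight q (fun s => s ^ (-θ) * b s) s * K s ^ q ≤
        C * (ENNReal.ofReal ((2 * x) ^ (-θ) * b (2 * x)) * K (2 * x)) ^ q := by
  obtain ⟨C, hC, h⟩ := hb.exists_rpow_mul_le (sub_pos.2 hθ)
  refine ⟨((2 * C) ^ q).toNNReal, fun K hK x hx => ?_⟩
  have h2x : 0 < 2 * x := by positivity
  have hw2 := hb.pos _ h2x
  set W := (2 * x) ^ (-θ) * b (2 * x) with hW
  have hWpos : 0 < W := by positivity
  have hpt : ∀ s ∈ Ioc x (2 * x), logWeight q (fun s => s ^ (-θ) * b s) s * K s ^ q ≤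
      ENNReal.ofReal ((2 * C * W) ^ q / x) * K (2 * x) ^ q := by
    intro s hs
    have hs0 : 0 < s := hx.trans hs.1
    have hbs := hb.pos s hs0
    have h1 := h s (2 * x) hs0 hs.2
    rw [rpow_one_sub_mul hs0, rpow_one_sub_mul h2x, ← hW] at h1
    have h2 : s ^ (-θ) * b s ≤ 2 * C * W := by
      refine le_of_mul_le_mul_left (h1.trans ?_) hs0
      have := mul_le_mul_of_nonneg_right hs.1.le (by positivity : 0 ≤ 2 * C * W)
      linarith
    have h3 := hs.1.le
    have h4 : K s ≤ K (2 * x) := hK hs.2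
    unfold logWeight
    gcongr
  refine (setLIntegral_mono' measurableSet_Ioc hpt).trans (le_of_eq ?_)
  rw [setLIntegral_const, Real.volume_Ioc, ENNReal.mul_rpow_of_nonneg _ _ hq.le,
    ENNReal.ofReal_rpow_of_nonneg hWpos.le hq.le]
  change _ = ENNReal.ofReal _ * _
  rw [mul_right_comm, ← ENNReal.ofReal_mul (by positivity),
    ← mul_assoc (ENNReal.ofReal _) (ENNReal.ofReal _), ← ENNReal.ofReal_mul (by positivity),
    Real.mul_rpow (x := 2 * C) (by positivity) hWpos.le]
  congr 2
  field_simp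
  ring

theorem SlowlyVarying.exists_le_lintegral_dyadic (hq : 0 < q) (hb : SlowlyVarying b)
    (hθ : θ < 1) : ∃ C : ℝ≥0, ∀ K : ℝ → ℝ≥0∞, Monotone K → ∀ x : ℝ, 0 < x →
      (ENNReal.ofReal (x ^ (-θ) * b x) * K x) ^ q ≤
      C * ∫⁻ s in Ioc x (2 * x), logWeight q (fun s => s ^ (-θ) * b s) s * K s ^ q := by
  obtain ⟨C, hC, h⟩ := hb.exists_rpow_mul_le (sub_pos.2 hθ)
  refine ⟨(2 * (2 * C) ^ q).toNNReal, fun K hK x hx => ?_⟩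
  have hbx := hb.pos _ hx
  set W := x ^ (-θ) * b x with hW
  have hWpos : 0 < W := by positivity
  have hpt : ∀ s ∈ Ioc x (2 * x), ENNReal.ofReal ((W / (2 * C)) ^ q / (2 * x)) * K x ^ q ≤
      logWeight q (fun s => s ^ (-θ) * b s) s * K s ^ q := by
    intro s hs
    have hs0 : 0 < s := hx.trans hs.1
    have hbs := hb.pos s hs0
    have h1 := h x s hx hs.1.le
    rw [rpow_one_sub_mul hs0, rpow_one_sub_mul hx, ← hW] at h1
    have h2 : W / (2 * C) ≤ s ^ (-θ) * b s := by
      rw [div_le_iff₀ (by positivity)]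
      refine le_of_mul_le_mul_left (h1.trans ?_) hx
      have := mul_le_mul_of_nonneg_right hs.2 (by positivity : 0 ≤ C * (s ^ (-θ) * b s))
      linarith
    have h3 := hs.2
    have h4 : K x ≤ K s := hK hs.1.le
    unfold logWeight
    gcongr
  refine le_trans (le_of_eq ?_) (mul_le_mul_right (setLIntegral_mono' measurableSet_Ioc hpt) _)
  rw [setLIntegral_const, Real.volume_Ioc, ENNReal.mul_rpow_of_nonneg _ _ hq.le,
    ENNReal.ofReal_rpow_of_nonneg hWpos.le hq.le]
  change _ = ENNReal.ofReal _ * _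
  rw [mul_right_comm, ← ENNReal.ofReal_mul (by positivity), ← mul_assoc,
    ← ENNReal.ofReal_mul (by positivity), Real.div_rpow hWpos.le (by positivity)]
  congr 2
  have : (2 * C) ^ q ≠ 0 := by positivity
  field_simp
  ring

variable {q₀ q₁ : ℝ} {b₀ b₁ : ℝ → ℝ}

theorem bTilde_nonneg (hq₀ : 0 < q₀) (hq₁ : 0 < q₁) (hb₀ : SlowlyVaryingZero q₀ b₀)
    (hb₁ : SlowlyVaryingZero q₁ b₁) (hb : SlowlyVarying b) {t : ℝ} (ht : 0 < t) :
    0 ≤ bTilde θ q q₀ q₁ b b₀ b₁ t := by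
  have hr := rho_pos hq₀ hq₁ hb₀ hb₁ ht
  have h1 := hb.pos _ hr
  have h2 := hb₁.pos t ht
  have h3 := hb₁.tailNorm_pos hq₁ ht
  rw [bTilde, hb₁.setIntegral_Ioi_eq hq₁ ht]
  positivity

/-- The exponents in `bTilde` are made for this: `b̃ ^ q du/u` has an explicit density, depending on
`ρ` and `T_1` only, with respect to `b₁ ^ q₁ du/u`, whose mass on `(t, ∞)` is `T_1(t) ^ q₁`. -/
theorem logWeight_bTilde (hq : 0 < q) (hq₀ : 0 < q₀) (hq₁ : 0 < q₁)
    (hb₀ : SlowlyVaryingZero q₀ b₀) (hb₁ : SlowlyVaryingZero q₁ b₁) (hb : SlowlyVarying b)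
    {t : ℝ} (ht : 0 < t) :
    logWeight q (bTilde θ q q₀ q₁ b b₀ b₁) t =
      ENNReal.ofReal ((rho q₀ q₁ b₀ b₁ t ^ (1 - θ) * b (rho q₀ q₁ b₀ b₁ t) *
        tailNorm q₁ b₁ t) ^ q / tailNorm q₁ b₁ t ^ q₁) * logWeight q₁ b₁ t := by
  have hr := rho_pos hq₀ hq₁ hb₀ hb₁ ht
  have h1 := hb.pos _ hr
  have h2 := hb₁.pos t ht
  have h3 := hb₁.tailNorm_pos hq₁ ht
  rw [logWeight, logWeight, ← ENNReal.ofReal_mul (by positivity), bTilde,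
    hb₁.setIntegral_Ioi_eq hq₁ ht]
  congr 1
  set φ := tailNorm q₁ b₁ t
  set v := rho q₀ q₁ b₀ b₁ t ^ (1 - θ) * b (rho q₀ q₁ b₀ b₁ t)
  have hv : 0 < v := by positivity
  have e1 : ((φ ^ q₁) ^ (1 / q₁ - 1 / q)) ^ q = φ ^ q / φ ^ q₁ := by
    rw [← Real.rpow_mul h3.le, ← Real.rpow_mul h3.le, ← Real.rpow_sub h3]
    congr 1
    field_simp
  have e2 : (b₁ t ^ (q₁ / q)) ^ q = b₁ t ^ q₁ := by
    rw [← Real.rpow_mul h2.le, div_mul_cancel₀ _ hq.ne']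
  rw [Real.mul_rpow (x := v * b₁ t ^ (q₁ / q)) (by positivity) (by positivity),
    Real.mul_rpow (x := v) hv.le (by positivity), e1, e2, Real.mul_rpow (x := v) hv.le h3.le]
  ring

theorem DyadicScale.rho_mem (S : DyadicScale q₀ q₁ b₀ b₁)
    (hmono : MonotoneOn (rho q₀ q₁ b₀ b₁) (Ioi 0)) {k : ℤ} {u : ℝ}
    (hu : u ∈ Ioc (S.t k) (S.t (k + 1))) :
    (2 : ℝ) ^ k ≤ rho q₀ q₁ b₀ b₁ u ∧ rho q₀ q₁ b₀ b₁ u ≤ 2 ^ (k + 1) := by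
  have hu0 : 0 < u := (S.pos k).trans hu.1
  rw [← S.rho_eq, ← S.rho_eq]
  exact ⟨hmono (S.pos k) hu0 hu.1.le, hmono hu0 (S.pos _) hu.2⟩

/-- On a block `ρ` varies by a factor 2 and `T_1` by at most `S.ratio`, so the density is
essentially constant and its denominator `T_1 ^ q₁` cancels the mass of the block. -/
theorem DyadicScale.exists_lintegral_bTilde_le (S : DyadicScale q₀ q₁ b₀ b₁) (hq : 0 < q)
    (hq₀ : 0 < q₀) (hq₁ : 0 < q₁) (hb₀ : SlowlyVaryingZero q₀ b₀)
    (hb₁ : SlowlyVaryingZero q₁ b₁) (hb : SlowlyVarying b) (hθ : θ < 1)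
    (hmono : MonotoneOn (rho q₀ q₁ b₀ b₁) (Ioi 0)) :
    ∃ C : ℝ≥0, ∀ ω : ℝ → ℝ≥0∞, Monotone ω → ∀ k : ℤ,
      ∫⁻ u in Ioc (S.t k) (S.t (k + 1)), logWeight q (bTilde θ q q₀ q₁ b b₀ b₁) u * ω u ^ q ≤
        C * (ENNReal.ofReal (((2 : ℝ) ^ (k + 1)) ^ (1 - θ) * b (2 ^ (k + 1))) *
          (ENNReal.ofReal (tailNorm q₁ b₁ (S.t (k + 1))) * ω (S.t (k + 1)))) ^ q := by
  obtain ⟨C, hC, h⟩ := hb.exists_rpow_mul_le (sub_pos.2 hθ)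
  have hL : 0 < S.ratio := zero_lt_one.trans_le S.one_le_ratio
  refine ⟨((C * S.ratio) ^ q * S.ratio ^ q₁).toNNReal, fun ω hω k => ?_⟩
  have hk1 := zpow_pos (zero_lt_two' ℝ) (k + 1)
  have hbk := hb.pos _ hk1
  have hy := hb₁.tailNorm_pos hq₁ (S.pos (k + 1))
  have hyx := S.le_ratio_mul k
  set y := tailNorm q₁ b₁ (S.t (k + 1))
  set v := ((2 : ℝ) ^ (k + 1)) ^ (1 - θ) * b (2 ^ (k + 1))
  have hv : 0 < v := by positivity
  have hpt : ∀ u ∈ Ioc (S.t k) (S.t (k + 1)),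
      logWeight q (bTilde θ q q₀ q₁ b b₀ b₁) u * ω u ^ q ≤
        ENNReal.ofReal ((C * v * (S.ratio * y)) ^ q / y ^ q₁) *
          (logWeight q₁ b₁ u * ω (S.t (k + 1)) ^ q) := by
    intro u hu
    have hu0 : 0 < u := (S.pos k).trans hu.1
    have hr := rho_pos hq₀ hq₁ hb₀ hb₁ hu0
    have hbr := hb.pos _ hr
    have hφ := hb₁.tailNorm_pos hq₁ hu0
    rw [logWeight_bTilde hq hq₀ hq₁ hb₀ hb₁ hb hu0, mul_assoc]
    have h1 := h _ _ hr (S.rho_mem hmono hu).2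
    have h2 := (hb₁.tailNorm_antitone hq₁ (S.pos k) hu.1.le).trans hyx
    have h3 : y ≤ tailNorm q₁ b₁ u := hb₁.tailNorm_antitone hq₁ hu0 hu.2
    have h4 := hω hu.2
    gcongr
  refine (setLIntegral_mono' measurableSet_Ioc hpt).trans ?_
  rw [lintegral_const_mul' _ _ ENNReal.ofReal_ne_top,
    lintegral_mul_const'' _ (hb₁.aemeasurable_logWeight_restrict
      (Ioc_subset_Ioi_self.trans (Ioi_subset_Ioi (S.pos k).le)))]
  have hmass : ∫⁻ u in Ioc (S.t k) (S.t (k + 1)), logWeight q₁ b₁ u ≤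
      ENNReal.ofReal ((S.ratio * y) ^ q₁) := by
    refine (lintegral_mono_set Ioc_subset_Ioi_self).trans ?_
    rw [hb₁.lintegral_Ioi_eq hq₁ (S.pos k)]
    have := tailNorm_nonneg (q := q₁) (b := b₁) (S.t k)
    gcongr
  refine (mul_le_mul_right (mul_le_mul_left hmass _) _).trans (le_of_eq ?_)
  change _ = ENNReal.ofReal _ * _
  rw [← mul_assoc (ENNReal.ofReal v), ← ENNReal.ofReal_mul hv.le,
    ENNReal.mul_rpow_of_nonneg _ _ hq.le, ENNReal.ofReal_rpow_of_nonneg (by positivity) hq.le,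
    ← mul_assoc (ENNReal.ofReal _) (ENNReal.ofReal _),
    ← mul_assoc (ENNReal.ofReal _) (ENNReal.ofReal _), ← ENNReal.ofReal_mul (by positivity),
    ← ENNReal.ofReal_mul (by positivity)]
  congr 2
  rw [show C * v * (S.ratio * y) = C * S.ratio * (v * y) by ring,
    Real.mul_rpow (x := C * S.ratio) (by positivity) (by positivity),
    Real.mul_rpow (x := S.ratio) (y := y) hL.le hy.le]
  have : y ^ q₁ ≠ 0 := by positivity
  field_simp

theorem DyadicScale.exists_le_lintegral_bTilde (S : DyadicScale q₀ q₁ b₀ b₁) (hq : 0 < q)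
    (hq₀ : 0 < q₀) (hq₁ : 0 < q₁) (hb₀ : SlowlyVaryingZero q₀ b₀)
    (hb₁ : SlowlyVaryingZero q₁ b₁) (hb : SlowlyVarying b) (hθ : θ < 1)
    (hmono : MonotoneOn (rho q₀ q₁ b₀ b₁) (Ioi 0)) :
    ∃ C : ℝ≥0, ∀ ω : ℝ → ℝ≥0∞, Monotone ω → ∀ k : ℤ,
      (ENNReal.ofReal (((2 : ℝ) ^ k) ^ (1 - θ) * b (2 ^ k)) *
        (ENNReal.ofReal (tailNorm q₁ b₁ (S.t k)) * ω (S.t k))) ^ q ≤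
      C * ∫⁻ u in Ioc (S.t k) (S.t (k + 1)),
        logWeight q (bTilde θ q q₀ q₁ b b₀ b₁) u * ω u ^ q := by
  obtain ⟨C, hC, h⟩ := hb.exists_rpow_mul_le (sub_pos.2 hθ)
  have hL : 0 < S.ratio := zero_lt_one.trans_le S.one_le_ratio
  -- Since `T_1` halves across a block, at least this proportion of the mass `T_1(t_k) ^ q₁` lies in
  -- the block.
  set δ : ℝ := 1 - (1 / 2) ^ q₁ with hδdef
  have hδ : 0 < δ := sub_pos.2 (Real.rpow_lt_one (by norm_num) (by norm_num) hq₁)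
  refine ⟨((C * S.ratio) ^ q * δ⁻¹).toNNReal, fun ω hω k => ?_⟩
  have hk := zpow_pos (zero_lt_two' ℝ) k
  have hbk := hb.pos _ hk
  have hx := hb₁.tailNorm_pos hq₁ (S.pos k)
  have hy := hb₁.tailNorm_pos hq₁ (S.pos (k + 1))
  have hyx := S.le_ratio_mul k
  have hxy := S.tailNorm_le k
  have hmass : ENNReal.ofReal (δ * tailNorm q₁ b₁ (S.t k) ^ q₁) ≤
      ∫⁻ u in Ioc (S.t k) (S.t (k + 1)), logWeight q₁ b₁ u := by
    rw [hb₁.lintegral_Ioc_eq hq₁ (S.pos k) (S.strictMono (lt_add_one k)).le]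
    refine ENNReal.ofReal_le_ofReal ?_
    have : tailNorm q₁ b₁ (S.t (k + 1)) ^ q₁ ≤ (1 / 2 * tailNorm q₁ b₁ (S.t k)) ^ q₁ :=
      Real.rpow_le_rpow hy.le (by linarith) hq₁.le
    rw [Real.mul_rpow (by norm_num) hx.le] at this
    rw [hδdef, sub_mul, one_mul]
    linarith
  set x := tailNorm q₁ b₁ (S.t k)
  set v := ((2 : ℝ) ^ k) ^ (1 - θ) * b (2 ^ k)
  have hv : 0 < v := by positivity
  have hpt : ∀ u ∈ Ioc (S.t k) (S.t (k + 1)),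
      ENNReal.ofReal ((v / C * (x / S.ratio)) ^ q / x ^ q₁) *
          (logWeight q₁ b₁ u * ω (S.t k) ^ q) ≤
      logWeight q (bTilde θ q q₀ q₁ b b₀ b₁) u * ω u ^ q := by
    intro u hu
    have hu0 : 0 < u := (S.pos k).trans hu.1
    have hr := rho_pos hq₀ hq₁ hb₀ hb₁ hu0
    have hbr := hb.pos _ hr
    have hφ := hb₁.tailNorm_pos hq₁ hu0
    rw [logWeight_bTilde hq hq₀ hq₁ hb₀ hb₁ hb hu0, mul_assoc]
    have h1 : v / C ≤ _ := (div_le_iff₀' hC).2 (h _ _ hk (S.rho_mem hmono hu).1)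
    have h2 : x / S.ratio ≤ tailNorm q₁ b₁ u :=
      ((div_le_iff₀' hL).2 hyx).trans (hb₁.tailNorm_antitone hq₁ hu0 hu.2)
    have h3 : tailNorm q₁ b₁ u ≤ x := hb₁.tailNorm_antitone hq₁ (S.pos k) hu.1.le
    have h4 := hω hu.1.le
    gcongr
  refine le_trans ?_ (mul_le_mul_right (setLIntegral_mono' measurableSet_Ioc hpt) _)
  rw [lintegral_const_mul' _ _ ENNReal.ofReal_ne_top,
    lintegral_mul_const'' _ (hb₁.aemeasurable_logWeight_restrict
      (Ioc_subset_Ioi_self.trans (Ioi_subset_Ioi (S.pos k).le)))]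
  refine le_trans (le_of_eq ?_) (mul_le_mul_right (mul_le_mul_right
    (mul_le_mul_left hmass _) _) _)
  change _ = ENNReal.ofReal _ * _
  rw [← mul_assoc (ENNReal.ofReal v), ← ENNReal.ofReal_mul hv.le,
    ENNReal.mul_rpow_of_nonneg _ _ hq.le, ENNReal.ofReal_rpow_of_nonneg (by positivity) hq.le,
    ← mul_assoc, ← mul_assoc, ← ENNReal.ofReal_mul (by positivity),
    ← ENNReal.ofReal_mul (by positivity)]
  congr 2
  rw [show v / C * (x / S.ratio) = (v * x) / (C * S.ratio) by field_simp,
    Real.div_rpow (x := v * x) (by positivity) (by positivity)]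
  have h5 : x ^ q₁ ≠ 0 := by positivity
  have h6 : (C * S.ratio) ^ q ≠ 0 := by positivity
  field_simp

end Blocks

/-! ### Comparison of the two norms -/

section Equivalence

variable {n : ℕ} {𝕜 : Type*} [RCLike 𝕜] {q θ : ℝ} {b : ℝ → ℝ}

theorem kInterpNorm_rpow {V : Type*} [AddCommGroup V] (A₀ A₁ : Set V) (N₀ N₁ : V → ℝ≥0∞)
    (hq : 0 < q) (hb : SlowlyVarying b) (f : V) :
    kInterpNorm A₀ A₁ N₀ N₁ θ q b f ^ q = ∫⁻ s in Ioi 0,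
      logWeight q (fun s => s ^ (-θ) * b s) s * kFunctional A₀ A₁ N₀ N₁ s f ^ q := by
  rw [kInterpNorm, eLpNorm'_eq_lintegral_enorm, ← ENNReal.rpow_mul, one_div_mul_cancel hq.ne',
    ENNReal.rpow_one]
  refine setLIntegral_congr_fun measurableSet_Ioi fun s hs => ?_
  have hs0 : 0 < s := hs
  have hbs := hb.pos s hs0
  rw [enorm_eq_self, show s ^ (-θ - 1 / q) * b s = s ^ (-(1 / q)) * (s ^ (-θ) * b s) by
    rw [← mul_assoc, ← Real.rpow_add hs0]; congr 2; ring]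
  exact ofReal_weight_mul_rpow hq hs0 (by positivity) _

theorem tsum_int_add_one (g : ℤ → ℝ≥0∞) : ∑' k : ℤ, g (k + 1) = ∑' k : ℤ, g k :=
  (Equiv.addRight (1 : ℤ)).tsum_eq g

theorem lintegral_Ioi_eq_tsum_dyadic (g : ℝ → ℝ≥0∞) :
    ∫⁻ s in Ioi 0, g s = ∑' k : ℤ, ∫⁻ s in Ioc ((2 : ℝ) ^ k) (2 * 2 ^ k), g s := by
  rw [lintegral_Ioi_eq_tsum_Ioc (a := fun k : ℤ => (2 : ℝ) ^ k)
    (zpow_right_mono₀ one_le_two) (fun k => zpow_pos zero_lt_two k)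
    (fun x hx => exists_mem_Ioc_zpow hx one_lt_two)]
  refine tsum_congr fun k => ?_
  rw [zpow_add_one₀ (two_ne_zero' ℝ), mul_comm]

variable {q₀ q₁ : ℝ} {b₀ b₁ : ℝ → ℝ}

theorem DyadicScale.weight_mul_eq (S : DyadicScale q₀ q₁ b₀ b₁) (hq₁ : 0 < q₁)
    (hb₁ : SlowlyVaryingZero q₁ b₁) (hb : SlowlyVarying b) (k : ℤ) (y : ℝ≥0∞) :
    ENNReal.ofReal (((2 : ℝ) ^ k) ^ (1 - θ) * b (2 ^ k)) *
        (ENNReal.ofReal (tailNorm q₁ b₁ (S.t k)) * y) =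
      ENNReal.ofReal (((2 : ℝ) ^ k) ^ (-θ) * b (2 ^ k)) *
        (ENNReal.ofReal (tailNorm q₀ b₀ (S.t k)) * y) := by
  have hk := zpow_pos (zero_lt_two' ℝ) k
  have hbk := hb.pos _ hk
  rw [S.tailNorm_zero_eq hq₁ hb₁, rpow_one_sub_mul hk, ENNReal.ofReal_mul hk.le,
    ENNReal.ofReal_mul hk.le]
  ring

/-- One value of `ω` per block is enough here, so the lower bound for `K` applies term by term and
no Hardy inequality is needed. -/
theorem exists_besovNorm_le_kInterpNorm (E : RIFunctionNorm n) (S : DyadicScale q₀ q₁ b₀ b₁)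
    (hq : 0 < q) (hq₀ : 0 < q₀) (hq₁ : 0 < q₁) (hb₀ : SlowlyVaryingZero q₀ b₀)
    (hb₁ : SlowlyVaryingZero q₁ b₁) (hb : SlowlyVarying b) (hθ : θ < 1)
    (hmono : MonotoneOn (rho q₀ q₁ b₀ b₁) (Ioi 0)) :
    ∃ C : ℝ≥0, ∀ f : EuclideanSpace ℝ (Fin n) →ₘ[volume] 𝕜,
      besovNorm E q (bTilde θ q q₀ q₁ b b₀ b₁) f ^ q ≤
        C * kInterpNorm (besovSpace E 𝕜 q₀ b₀) (besovSpace E 𝕜 q₁ b₁)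
          (besovNorm E q₀ b₀) (besovNorm E q₁ b₁) θ q b f ^ q := by
  obtain ⟨C, hC⟩ := S.exists_lintegral_bTilde_le hq hq₀ hq₁ hb₀ hb₁ hb hθ hmono
  obtain ⟨C', hC'⟩ := hb.exists_le_lintegral_dyadic hq hθ
  refine ⟨C * C', fun f => ?_⟩
  rw [besovNorm_rpow E hq fun u hu => bTilde_nonneg hq₀ hq₁ hb₀ hb₁ hb hu,
    lintegral_Ioi_eq_tsum_Ioc S.strictMono.monotone S.pos S.cover,
    kInterpNorm_rpow _ _ _ _ hq hb, lintegral_Ioi_eq_tsum_dyadic]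
  refine (ENNReal.tsum_le_tsum fun k => hC _ (modulus_mono E f) k).trans ?_
  rw [ENNReal.tsum_mul_left, ENNReal.coe_mul, mul_assoc]
  refine mul_le_mul_right ?_ _
  rw [tsum_int_add_one (fun k => (ENNReal.ofReal (((2 : ℝ) ^ k) ^ (1 - θ) * b (2 ^ k)) *
    (ENNReal.ofReal (tailNorm q₁ b₁ (S.t k)) * modulus E f (S.t k))) ^ q),
    ← ENNReal.tsum_mul_left]
  refine ENNReal.tsum_le_tsum fun k => ?_
  refine le_trans ?_ (hC' _ (kFunctional_mono _ _ _ _ f) _ (zpow_pos zero_lt_two k))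
  rw [S.weight_mul_eq hq₁ hb₁ hb]
  refine ENNReal.rpow_le_rpow (mul_le_mul_right ?_ _) hq.le
  rw [← S.rho_eq]
  exact tailNorm_mul_modulus_le_kFunctional E hq₀ hq₁ hb₀ hb₁ f (S.pos k)

/-- The `q₀`-sum runs to the left of `k`, against the weights `2 ^ (-kθ) b(2 ^ k)`, which decay as
`θ > 0`; the `q₁`-sum runs to the right, against `2 ^ (k(1-θ)) b(2 ^ k)`, which grow as `θ < 1`.
Hardy's inequality reduces both to the same sequence, by `weight_mul_eq`. -/
theorem exists_kInterpNorm_le_besovNorm (E : RIFunctionNorm n) (S : DyadicScale q₀ q₁ b₀ b₁)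
    (hq : 0 < q) (hq₀ : 0 < q₀) (hq₁ : 0 < q₁) (hb₀ : SlowlyVaryingZero q₀ b₀)
    (hb₁ : SlowlyVaryingZero q₁ b₁) (hb : SlowlyVarying b) (hθ₀ : 0 < θ) (hθ : θ < 1)
    (hmono : MonotoneOn (rho q₀ q₁ b₀ b₁) (Ioi 0)) :
    ∃ C : ℝ≥0, ∀ f ∈ E.space 𝕜,
      kInterpNorm (besovSpace E 𝕜 q₀ b₀) (besovSpace E 𝕜 q₁ b₁)
        (besovNorm E q₀ b₀) (besovNorm E q₁ b₁) θ q b f ^ q ≤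
      C * besovNorm E q (bTilde θ q q₀ q₁ b b₀ b₁) f ^ q := by
  obtain ⟨C₁, hC₁⟩ := hb.exists_lintegral_dyadic_le hq hθ
  obtain ⟨C₂, hC₂⟩ := S.exists_le_lintegral_bTilde hq hq₀ hq₁ hb₀ hb₁ hb hθ hmono
  obtain ⟨c₀, c₁, hK⟩ := exists_kFunctional_le n hq₀ hq₁ hb₀ hb₁ S
  obtain ⟨d₀, μ₀, hμ₀, hd₀⟩ := hb.exists_dyadic_decay hθ₀
  obtain ⟨d₁, μ₁, hμ₁, hd₁⟩ := hb.exists_dyadic_growth (sub_pos.2 hθ)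
  obtain ⟨H₀, hH₀⟩ := tsum_weighted_hardy hμ₀ hq₀ hq d₀ c₀
  obtain ⟨H₁, hH₁⟩ := tsum_weighted_hardy hμ₁ hq₁ hq d₁ c₁
  refine ⟨C₁ * (2 ^ q * ((H₀ + H₁) * C₂)), fun f hf => ?_⟩
  rw [besovNorm_rpow E hq fun u hu => bTilde_nonneg hq₀ hq₁ hb₀ hb₁ hb hu,
    kInterpNorm_rpow _ _ _ _ hq hb, lintegral_Ioi_eq_tsum_dyadic,
    lintegral_Ioi_eq_tsum_Ioc S.strictMono.monotone S.pos S.cover]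
  set K := fun s => kFunctional (besovSpace E 𝕜 q₀ b₀) (besovSpace E 𝕜 q₁ b₁)
    (besovNorm E q₀ b₀) (besovNorm E q₁ b₁) s f with hKdef
  let W : ℤ → ℝ≥0∞ := fun k => ENNReal.ofReal (((2 : ℝ) ^ k) ^ (-θ) * b (2 ^ k))
  let V : ℤ → ℝ≥0∞ := fun k => ENNReal.ofReal (((2 : ℝ) ^ k) ^ (1 - θ) * b (2 ^ k))
  let A : ℤ → ℝ≥0∞ := fun k => ENNReal.ofReal (tailNorm q₀ b₀ (S.t k)) * modulus E f (S.t k)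
  let B : ℤ → ℝ≥0∞ := fun k => ENNReal.ofReal (tailNorm q₁ b₁ (S.t k)) * modulus E f (S.t k)
  have hVB : ∀ k, V k * B k = W k * A k := fun k => S.weight_mul_eq hq₁ hb₁ hb k _
  have hVW : ∀ k : ℤ, V k = ENNReal.ofReal (2 ^ k) * W k := fun k => by
    have hk := zpow_pos (zero_lt_two' ℝ) k
    simp only [V, W]
    rw [rpow_one_sub_mul hk, ENNReal.ofReal_mul hk.le]
  calc ∑' k : ℤ, ∫⁻ s in Ioc ((2 : ℝ) ^ k) (2 * 2 ^ k),
        logWeight q (fun s => s ^ (-θ) * b s) s * K s ^ q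
      ≤ ∑' k : ℤ, C₁ * (W (k + 1) * K (2 ^ (k + 1))) ^ q := by
        refine ENNReal.tsum_le_tsum fun k => ?_
        refine (hC₁ K (kFunctional_mono _ _ _ _ f) _ (zpow_pos zero_lt_two k)).trans ?_
        simp only [W]
        rw [zpow_add_one₀ (two_ne_zero' ℝ), mul_comm (2 : ℝ)]
    _ = C₁ * ∑' k : ℤ, (W k * K (2 ^ k)) ^ q := by
        rw [ENNReal.tsum_mul_left, tsum_int_add_one fun k => (W k * K (2 ^ k)) ^ q]
    _ ≤ C₁ * ∑' k : ℤ, 2 ^ q *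
          ((W k * (c₀ * ∑' i : ℕ, A (k + -(i : ℤ)) ^ q₀) ^ (1 / q₀)) ^ q +
            (V k * (c₁ * ∑' i : ℕ, B (k + i) ^ q₁) ^ (1 / q₁)) ^ q) := by
        refine mul_le_mul_right (ENNReal.tsum_le_tsum fun k => ?_) _
        refine le_trans (ENNReal.rpow_le_rpow ?_ hq.le) (add_rpow_le_two_rpow_mul _ _ hq)
        refine (mul_le_mul_right (hK E 𝕜 f hf k) (W k)).trans (le_of_eq ?_)
        rw [hVW, mul_add]
        simp only [A, B]
        ring
    _ = C₁ * (2 ^ q * (∑' k : ℤ, (W k * (c₀ * ∑' i : ℕ, A (k + -(i : ℤ)) ^ q₀) ^ (1 / q₀)) ^ q +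
          ∑' k : ℤ, (V k * (c₁ * ∑' i : ℕ, B (k + i) ^ q₁) ^ (1 / q₁)) ^ q)) := by
        rw [ENNReal.tsum_mul_left, ENNReal.tsum_add]
    _ ≤ C₁ * (2 ^ q * (H₀ * ∑' k : ℤ, (W k * A k) ^ q + H₁ * ∑' k : ℤ, (V k * B k) ^ q)) := by
        refine mul_le_mul_right (mul_le_mul_right (add_le_add ?_ ?_) _) _
        · exact hH₀ (fun i => -(i : ℤ)) W A hd₀
        · exact hH₁ (fun i => (i : ℤ)) V B hd₁
    _ = C₁ * (2 ^ q * ((H₀ + H₁) * ∑' k : ℤ, (V k * B k) ^ q)) := by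
        simp_rw [hVB]
        ring
    _ ≤ C₁ * (2 ^ q * ((H₀ + H₁) * (C₂ * ∑' k : ℤ, ∫⁻ u in Ioc (S.t k) (S.t (k + 1)),
          logWeight q (bTilde θ q q₀ q₁ b b₀ b₁) u * modulus E f u ^ q))) := by
        rw [← ENNReal.tsum_mul_left (a := (C₂ : ℝ≥0∞))]
        refine mul_le_mul_right (mul_le_mul_right (mul_le_mul_right
          (ENNReal.tsum_le_tsum fun k => ?_) _) _) _
        exact hC₂ _ (modulus_mono E f) k
    _ = _ := by
        rw [ENNReal.coe_mul, ENNReal.coe_mul, ENNReal.coe_mul, ENNReal.coe_add,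
          ENNReal.coe_rpow_of_nonneg _ hq.le, ENNReal.coe_ofNat]
        ring

theorem le_mul_of_rpow_le {x y : ℝ≥0∞} {c C : ℝ≥0} (hq : 0 < q) (h : x ^ q ≤ c * y ^ q)
    (hC : c ^ (1 / q) ≤ C) : x ≤ C * y := by
  refine (le_rpow_one_div hq h).trans ?_
  rw [ENNReal.mul_rpow_of_nonneg _ _ (by positivity), ← ENNReal.rpow_mul,
    mul_one_div_cancel hq.ne', ENNReal.rpow_one, ← ENNReal.coe_rpow_of_nonneg _ (by positivity)]
  gcongr

/-- Outside the sum the infimum defining `K` is over an empty family, hence infinite, and the weight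
is positive. -/
theorem mem_add_of_kInterpNorm_lt_top {V : Type*} [AddCommGroup V] {A₀ A₁ : Set V}
    {N₀ N₁ : V → ℝ≥0∞} (hq : 0 < q) (hb : SlowlyVarying b) {f : V}
    (h : kInterpNorm A₀ A₁ N₀ N₁ θ q b f < ∞) : f ∈ A₀ + A₁ := by
  by_contra hf
  have hK : ∀ s, kFunctional A₀ A₁ N₀ N₁ s f = ∞ := by
    intro s
    simp only [kFunctional, iInf_eq_top]
    intro f₀ h₀ f₁ h₁ hff
    exact absurd (hff ▸ Set.add_mem_add h₀ h₁) hf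
  have h1 := ENNReal.rpow_lt_top_of_nonneg hq.le h.ne
  rw [kInterpNorm_rpow A₀ A₁ N₀ N₁ hq hb] at h1
  refine h1.ne (top_unique ?_)
  have h2 : ∀ s ∈ Ioi (0 : ℝ), ∞ ≤
      logWeight q (fun s => s ^ (-θ) * b s) s * kFunctional A₀ A₁ N₀ N₁ s f ^ q := by
    intro s hs
    have hs0 : 0 < s := hs
    have hbs := hb.pos s hs0
    rw [hK, ENNReal.top_rpow_of_pos hq, ENNReal.mul_top]
    exact (ENNReal.ofReal_pos.2 (by positivity)).ne'
  refine le_trans (le_of_eq ?_) (setLIntegral_mono' measurableSet_Ioi h2)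
  rw [setLIntegral_const, Real.volume_Ioi, ENNReal.top_mul_top]

end Equivalence

end LimitingInterpolation

/-! ### The interpolation theorem -/

open LimitingInterpolation in
theorem mainTheorem12 {n : ℕ} {𝕜 : Type*} [RCLike 𝕜] (E : RIFunctionNorm n)
    (q₀ q₁ q θ : ℝ) (hq₀ : 0 < q₀) (hq₁ : 0 < q₁) (hne : q₀ ≠ q₁) (hq : 0 < q)
    (hθ₀ : 0 < θ) (hθ₁ : θ < 1)
    (b₀ b₁ b : ℝ → ℝ) (hb₀ : SlowlyVaryingZero q₀ b₀) (hb₁ : SlowlyVaryingZero q₁ b₁)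
    (hb : SlowlyVarying b)
    (hcond : RhoCondition q₀ q₁ b₀ b₁)
    (hmono : MonotoneOn (rho q₀ q₁ b₀ b₁) (Set.Ioi 0))
    (hzero : Filter.Tendsto (rho q₀ q₁ b₀ b₁) (𝓝[>] 0) (𝓝 0))
    (htop : Filter.Tendsto (rho q₀ q₁ b₀ b₁) Filter.atTop Filter.atTop) :
    kInterpSpace (besovSpace E 𝕜 q₀ b₀) (besovSpace E 𝕜 q₁ b₁)
        (besovNorm E q₀ b₀) (besovNorm E q₁ b₁) θ q b =
      besovSpace E 𝕜 q (bTilde θ q q₀ q₁ b b₀ b₁) ∧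
    ∃ C : ℝ≥0, ∀ f ∈ besovSpace E 𝕜 q (bTilde θ q q₀ q₁ b b₀ b₁),
      kInterpNorm (besovSpace E 𝕜 q₀ b₀) (besovSpace E 𝕜 q₁ b₁)
          (besovNorm E q₀ b₀) (besovNorm E q₁ b₁) θ q b f ≤
        C * besovNorm E q (bTilde θ q q₀ q₁ b b₀ b₁) f ∧
      besovNorm E q (bTilde θ q q₀ q₁ b b₀ b₁) f ≤
        C * kInterpNorm (besovSpace E 𝕜 q₀ b₀) (besovSpace E 𝕜 q₁ b₁)
          (besovNorm E q₀ b₀) (besovNorm E q₁ b₁) θ q b f := by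
  obtain ⟨S⟩ := nonempty_dyadicScale hq₀ hq₁ hb₀ hb₁ hcond hmono hzero htop
  obtain ⟨c, hc⟩ := exists_kInterpNorm_le_besovNorm (𝕜 := 𝕜) E S hq hq₀ hq₁ hb₀ hb₁ hb hθ₀ hθ₁
    hmono
  obtain ⟨d, hd⟩ := exists_besovNorm_le_kInterpNorm (𝕜 := 𝕜) E S hq hq₀ hq₁ hb₀ hb₁ hb hθ₁ hmono
  set C : ℝ≥0 := max (c ^ (1 / q)) (d ^ (1 / q))
  have hc' := fun f hf => le_mul_of_rpow_le hq (hc f hf) (le_max_left _ _ : _ ≤ C)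
  have hd' := fun f => le_mul_of_rpow_le hq (hd f) (le_max_right _ _ : _ ≤ C)
  refine ⟨Set.Subset.antisymm (fun f hf => ?_) (fun f hf => ?_), C, fun f hf =>
    ⟨hc' f hf.1, hd' f⟩⟩
  · obtain ⟨⟨f₀, h₀, f₁, h₁, rfl⟩, hfin⟩ := hf
    exact ⟨E.add_mem_space h₀.1 h₁.1,
      (hd' _).trans_lt (ENNReal.mul_lt_top ENNReal.coe_lt_top hfin)⟩
  · have hfin := (hc' f hf.1).trans_lt (ENNReal.mul_lt_top ENNReal.coe_lt_top hf.2)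
    exact ⟨mem_add_of_kInterpNorm_lt_top hq hb hfin, hfin⟩
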